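/- **Schwarz–Pick lemma on noncommutative polyballs.** Let $\mathcal H$ be a separable infinite dimensional complex Hilbert space, $k\ge 1$ and $\mathbf n=(n_1,\dots,n_k)$ with $n_i\in\{1,2,\dots\}$. For $m\ge1$ let $[B(\mathcal H)^{m}]_1=\{(X_1,\dots,X_m)\in B(\mathcal H)^m:\ \|X_1X_1^*+\cdots+X_mX_m^*\|^{1/2}<1\}$. The regular polyball $\mathbf B_{\mathbf n}(\mathcal H)$ is the set of all $\mathbf X=(X_1,\dots,X_k)$, $X_i=(X_{i,1},\dots,X_{i,n_i})\in[B(\mathcal H)^{n_i}]_1$, such that the entries of $X_s$ commute with the entries of $X_t$ for $s\ne t$ and $\big((\mathrm{id}-\Phi_{X_1})\circ\cdots\circ(\mathrm{id}-\Phi_{X_k})\big)(I)$ is positive and invertible, where $\Phi_{X_i}(Y)=\sum_{j=1}^{n_i}X_{i,j}YX_{i,j}^*$. Let $\mathbf B_{\mathbf n}(\mathcal H)^-$ be its closure in the operator norm topology. For a word $\alpha=g_{j_1}\cdots g_{j_p}$ in the free unital semigroup $\mathbb F_{m}^+$ on $m$ generators put $|\alpha|=p$ and $X_{\alpha}=X_{j_1}\cdots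 X_{j_p}$ (the identity $I$ for the empty word); for a tuple $\mathbf X$ as above and $\alpha\in\mathbb F_{n_i}^+$ write $X_{i,\alpha}=(X_i)_\alpha$. A function $f:[B(\mathcal H)^{m}]_1\to B(\mathcal H)$ is *free holomorphic* if there are scalars $c_\alpha$, $\alpha\in\mathbb F_m^+$, with $f(X)=\sum_{p=0}^\infty\sum_{|\alpha|=p}c_\alpha X_\alpha$ in operator norm for all $X\in[B(\mathcal H)^m]_1$. For a separable complex Hilbert space $\mathcal E$, a function $F$ on $\mathbf B_{\mathbf n}(\mathcal H)$ with values in $B(\mathcal E)\otimes_{min}B(\mathcal H)\subset B(\mathcal E\otimes\mathcal H)$ is *free $k$-pluriharmonic* if there are $A_{(\alpha_1,\dots,\alpha_k;\beta_1,\dots,\beta_k)}\in B(\mathcal E)$ such that, for all $\mathbf X\in\mathbf B_{\mathbf n}(\mathcal H)$, $$F(\mathbf X)=\sum_{(m_1,\dots,m_k)\in\mathbb Z^k}\ \sum_{|\alpha_i|=m_i^-,\ |\beta_i|=m_i^+}A_{(\alpha_1,\dots,\alpha_k;\beta_1,\dots,\beta_k)}\otimes X_{1,\alpha_1}\cdots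 X_{k,\alpha_k}X_{1,\beta_1}^*\cdots X_{k,\beta_k}^*,$$ where $\alpha_i,\beta_i\in\mathbb F_{n_i}^+$, $m^+=\max\{m,0\}$, $m^-=\max\{-m,0\}$, and the series over $\mathbb Z^k$ converges in operator norm irrespective of the order of summation; $F$ is *positive* if $F(\mathbf X)\ge0$ for all $\mathbf X\in\mathbf B_{\mathbf n}(\mathcal H)$. For $\mathbf A,\mathbf B\in\mathbf B_{\mathbf n}(\mathcal H)^-$ and $c>0$ write $\mathbf A\prec_c\mathbf B$ if $F(r\mathbf A)\le c^2F(r\mathbf B)$ for every $r\in[0,1)$, every separable Hilbert space $\mathcal E$ and every positive free $k$-pluriharmonic $F$ with coefficients in $B(\mathcal E)$. Call $\mathbf A,\mathbf B$ *Harnack equivalent* if $\mathbf A\prec_c\mathbf B$ and $\mathbf B\prec_{c'}\mathbf A$ for some $c,c'>0$, and for Harnack equivalent $\mathbf A,\mathbf B$ put $$\delta_H(\mathbf A,\mathbf B)=\ln\inf\{c>1:\ \mathbf A\prec_c\mathbf B\text{ and }\mathbf B\prec_c\mathbf A\}.$$ Let $\mathbf G(\mathbf X)=(G_1(X_1),\dots,G_k(X_k))$,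 where $G_i=(G_{i,1},\dots,G_{i,n_i})$ and each $G_{i,j}:[B(\mathcal H)^{n_i}]_1\to B(\mathcal H)$ is free holomorphic, and suppose that $\mathbf G(\mathbf X)\in\mathbf B_{\mathbf n}(\mathcal H)^-$ for every $\mathbf X\in\mathbf B_{\mathbf n}(\mathcal H)$. If $\mathbf X,\mathbf Y\in\mathbf B_{\mathbf n}(\mathcal H)$, then $\mathbf X$ and $\mathbf Y$ are Harnack equivalent, $\mathbf G(\mathbf X)$ and $\mathbf G(\mathbf Y)$ are Harnack equivalent, and $$\delta_H(\mathbf G(\mathbf X),\mathbf G(\mathbf Y))\le\delta_H(\mathbf X,\mathbf Y).$$ -/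

import Mathlib

open scoped TensorProduct

noncomputable section

namespace Polyball

/-- Tuples `X = (X₁, …, X_k)` with `X_i = (X_{i,1}, …, X_{i,n_i}) ∈ B(H)^{n_i}`, with the (product)
operator norm topology. -/
abbrev Tuple {k : ℕ} (n : Fin k → ℕ) (H : Type*) [NormedAddCommGroup H] [InnerProductSpace ℂ H] :
    Type _ :=
  (i : Fin k) → Fin (n i) → (H →L[ℂ] H)

/-- The open ball `[B(H)^m]₁` of strict row contractions. The condition
`‖X₁X₁* + ⋯ + X_mX_m*‖^{1/2} < 1` is written without the square root. -/
def openBall (m : ℕ) (H : Type*) [NormedAddCommGroup H] [InnerProductSpace ℂ H]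
    [CompleteSpace H] : Set (Fin m → (H →L[ℂ] H)) :=
  {X | ‖∑ j, X j * star (X j)‖ < 1}

/-- The completely positive map `Φ_X(Y) = ∑_j X_j Y X_j*`. -/
def cpMap {m : ℕ} {H : Type*} [NormedAddCommGroup H] [InnerProductSpace ℂ H]
    [CompleteSpace H] (X : Fin m → (H →L[ℂ] H)) : Module.End ℂ (H →L[ℂ] H) :=
  ∑ j, LinearMap.mulLeft ℂ (X j) ∘ₗ LinearMap.mulRight ℂ (star (X j))

/-- The defect mapping `Δ_X = (id - Φ_{X₁}) ∘ ⋯ ∘ (id - Φ_{X_k})`; multiplication in `Module.End`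
is composition. -/
def defectMap {k : ℕ} {n : Fin k → ℕ} {H : Type*} [NormedAddCommGroup H] [InnerProductSpace ℂ H]
    [CompleteSpace H] (X : Tuple n H) : Module.End ℂ (H →L[ℂ] H) :=
  (List.ofFn fun i => (1 : Module.End ℂ (H →L[ℂ] H)) - cpMap (X i)).prod

/-- The regular polyball `B_n(H)`: the entries of `X_s` commute with those of `X_t` for `s ≠ t`, each
`X_i` is in the open ball, and `Δ_X(I)` is positive and invertible. -/
def openPolyball {k : ℕ} (n : Fin k → ℕ) (H : Type*) [NormedAddCommGroup H]
    [InnerProductSpace ℂ H] [CompleteSpace H] : Set (Tuple n H) :=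
  {X | (∀ s t, s ≠ t → ∀ p q, Commute (X s p) (X t q)) ∧
    (∀ i, X i ∈ openBall (n i) H) ∧
    IsStrictlyPositive (defectMap X (1 : H →L[ℂ] H))}

/-- The closed polyball `B_n(H)⁻`, the closure in the operator norm topology. -/
def closedPolyball {k : ℕ} (n : Fin k → ℕ) (H : Type*) [NormedAddCommGroup H]
    [InnerProductSpace ℂ H] [CompleteSpace H] : Set (Tuple n H) :=
  closure (openPolyball n H)

/-- The word `g_{w 0} g_{w 1} ⋯ g_{w (p-1)}` of length `p` in the free semigroup on `m` generators. -/
def word {m p : ℕ} (w : Fin p → Fin m) : FreeMonoid (Fin m) :=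
  FreeMonoid.ofList (List.ofFn w)

/-- `X_α = X_{j₁} ⋯ X_{j_p}` for `α = g_{j₁} ⋯ g_{j_p}`, and `X_{g₀} = I`. -/
def monomial {m : ℕ} {H : Type*} [NormedAddCommGroup H] [InnerProductSpace ℂ H]
    (X : Fin m → (H →L[ℂ] H)) (α : FreeMonoid (Fin m)) : H →L[ℂ] H :=
  FreeMonoid.lift X α

/-- Free holomorphic functions on `[B(H)^m]₁` with values in `B(H)`:
`f(X) = ∑_p ∑_{|α| = p} c_α X_α`, the series in `p` converging in the operator norm. -/
def IsFreeHolomorphic {m : ℕ} {H : Type*} [NormedAddCommGroup H] [InnerProductSpace ℂ H]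
    [CompleteSpace H] (f : (Fin m → (H →L[ℂ] H)) → (H →L[ℂ] H)) : Prop :=
  ∃ c : FreeMonoid (Fin m) → ℂ, ∀ X ∈ openBall m H,
    HasSum (fun p : ℕ => ∑ w : Fin p → Fin m, c (word w) • monomial X (word w)) (f X)

/-- The Hilbert space tensor product `E ⊗ H`. -/
abbrev HilbertTensor (E H : Type*) [NormedAddCommGroup E] [InnerProductSpace ℂ E]
    [NormedAddCommGroup H] [InnerProductSpace ℂ H] : Type _ :=
  UniformSpace.Completion (E ⊗[ℂ] H)

/-- The operator `A ⊗ T` on the Hilbert space tensor product `E ⊗ H`. -/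
def opTensor {E H : Type*} [NormedAddCommGroup E] [InnerProductSpace ℂ E]
    [NormedAddCommGroup H] [InnerProductSpace ℂ H] (A : E →L[ℂ] E) (T : H →L[ℂ] H) :
    HilbertTensor E H →L[ℂ] HilbertTensor E H :=
  (TensorProduct.mapL A T).completion

/-- `X_{1,α₁} ⋯ X_{k,α_k} X_{1,β₁}* ⋯ X_{k,β_k}*`. -/
def biMonomial {k : ℕ} {n : Fin k → ℕ} {H : Type*} [NormedAddCommGroup H]
    [InnerProductSpace ℂ H] [CompleteSpace H] (X : Tuple n H)
    (α β : (i : Fin k) → FreeMonoid (Fin (n i))) : H →L[ℂ] H :=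
  (List.ofFn fun i => monomial (X i) (α i)).prod *
    (List.ofFn fun i => star (monomial (X i) (β i))).prod

/-- The block of multi-degree `m ∈ ℤ^k` of a `k`-pluriharmonic series: the finite sum of
`A_{(α;β)} ⊗ X_{1,α₁} ⋯ X_{k,α_k} X_{1,β₁}* ⋯ X_{k,β_k}*` over all words with `|α_i| = m_i⁻` and
`|β_i| = m_i⁺`. -/
def pluriBlock {k : ℕ} {n : Fin k → ℕ} {E H : Type*} [NormedAddCommGroup E]
    [InnerProductSpace ℂ E] [NormedAddCommGroup H] [InnerProductSpace ℂ H] [CompleteSpace H]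
    (A : ((i : Fin k) → FreeMonoid (Fin (n i))) → ((i : Fin k) → FreeMonoid (Fin (n i))) →
      (E →L[ℂ] E))
    (X : Tuple n H) (m : Fin k → ℤ) : HilbertTensor E H →L[ℂ] HilbertTensor E H :=
  ∑ α : (i : Fin k) → (Fin (-m i).toNat → Fin (n i)),
    ∑ β : (i : Fin k) → (Fin (m i).toNat → Fin (n i)),
      opTensor (A (fun i => word (α i)) (fun i => word (β i)))
        (biMonomial X (fun i => word (α i)) (fun i => word (β i)))

/-- Free `k`-pluriharmonic functions on `B_n(H)` with coefficients in `B(E)`: the multi-series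
converges in the operator norm of `B(E ⊗ H)`, in any order. -/
def IsFreePluriharmonic {k : ℕ} {n : Fin k → ℕ} {E H : Type*} [NormedAddCommGroup E]
    [InnerProductSpace ℂ E] [NormedAddCommGroup H] [InnerProductSpace ℂ H] [CompleteSpace H]
    (F : Tuple n H → (HilbertTensor E H →L[ℂ] HilbertTensor E H)) : Prop :=
  ∃ A : ((i : Fin k) → FreeMonoid (Fin (n i))) → ((i : Fin k) → FreeMonoid (Fin (n i))) →
      (E →L[ℂ] E),
    ∀ X ∈ openPolyball n H, HasSum (fun m : Fin k → ℤ => pluriBlock A X m) (F X)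

/-- Harnack domination with constant `c`, for `A, B ∈ B_n(H)⁻`: `F(rA) ≤ c² F(rB)` for all positive
free `k`-pluriharmonic `F` with coefficients in `B(E)`, `E` a separable Hilbert space, and all
`r ∈ [0,1)`. Every separable Hilbert space is isometric to one in `Type`. -/
def HarnackDominatedWith {k : ℕ} {n : Fin k → ℕ} {H : Type*} [NormedAddCommGroup H]
    [InnerProductSpace ℂ H] [CompleteSpace H] (c : ℝ) (A B : Tuple n H) : Prop :=
  ∀ (E : Type) [NormedAddCommGroup E] [InnerProductSpace ℂ E] [CompleteSpace E]
    [TopologicalSpace.SeparableSpace E]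
    (F : Tuple n H → (HilbertTensor E H →L[ℂ] HilbertTensor E H)),
    IsFreePluriharmonic F → (∀ X ∈ openPolyball n H, 0 ≤ F X) →
    ∀ r : ℝ, 0 ≤ r → r < 1 →
      F ((r : ℂ) • A) ≤ ((c ^ 2 : ℝ) : ℂ) • F ((r : ℂ) • B)

/-- Harnack domination: domination with some constant `c > 0`. -/
def HarnackDominated {k : ℕ} {n : Fin k → ℕ} {H : Type*} [NormedAddCommGroup H]
    [InnerProductSpace ℂ H] [CompleteSpace H] (A B : Tuple n H) : Prop :=
  ∃ c : ℝ, 0 < c ∧ HarnackDominatedWith c A B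

/-- Harnack equivalence, the equivalence relation induced by Harnack domination. -/
def HarnackEquiv {k : ℕ} {n : Fin k → ℕ} {H : Type*} [NormedAddCommGroup H]
    [InnerProductSpace ℂ H] [CompleteSpace H] (A B : Tuple n H) : Prop :=
  HarnackDominated A B ∧ HarnackDominated B A

/-- Harnack equivalence with constant `c`. -/
def HarnackEquivWith {k : ℕ} {n : Fin k → ℕ} {H : Type*} [NormedAddCommGroup H]
    [InnerProductSpace ℂ H] [CompleteSpace H] (c : ℝ) (A B : Tuple n H) : Prop :=
  HarnackDominatedWith c A B ∧ HarnackDominatedWith c B A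

/-- The hyperbolic metric `δ_H(A, B) = ln inf {c > 1 : A and B are Harnack equivalent with constant
c}`, for Harnack equivalent `A` and `B` (the set is then non-empty and bounded below by `1`). -/
def hyperbolicDist {k : ℕ} {n : Fin k → ℕ} {H : Type*} [NormedAddCommGroup H]
    [InnerProductSpace ℂ H] [CompleteSpace H] (A B : Tuple n H) : ℝ :=
  Real.log (sInf {c : ℝ | 1 < c ∧ HarnackEquivWith c A B})

end Polyball

end

/-! Let `F` be positive and pluriharmonic, `r < 1`, and put `F_r(X) = F(r G(X))`. If `F_r` is again
free pluriharmonic (its positivity is clear), then domination of `X` by `Y` with constant `c`,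
tested on `F_r`, gives `F_r(sX) ≤ c² F_r(sY)` for `s < 1`, and `s → 1` gives `F(rG(X)) ≤ c²
F(rG(Y))`. So every constant admissible for `X, Y` is admissible for `G(X), G(Y)`, and the infimum
can only drop (`HarnackDominatedWith.map`). It remains to see that points of the open polyball are
Harnack equivalent (`harnackDominated_of_mem_openPolyball`) and that `F_r` is pluriharmonic
(`isFreePluriharmonic_comp`).

Both rest on the torus action. Rotating each `X_i` by a unimodular scalar preserves the polyball and
turns the blocks of multi-degree `m` into the Fourier coefficients of `t ↦ ⟪x, F(t·X) y⟫`. For `x =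
y` this function is nonnegative, so each coefficient is bounded by the zeroth one, which does not
depend on `X`. Writing a point as `ρX'` with `ρ < 1` and `X'` still in the polyball damps the block
`m` by `ρ^|m|`; this gives two-sided Harnack bounds against the constant block.

For the composition, `F(rG(X)) = ∑_m Q_m(X)`, and each `Q_m` is expanded in `X` by multiplying the
power series of the entries of `G`. The block bounds give `‖Q_m(X)‖ ≤ const · q^|m|` with `q < 1`,
Cauchy estimates on the torus pass this to the blocks of `Q_m`, and the damping of `X = ρX'` makes
the double series absolutely convergent, so it can be rearranged by degree in `X`. The operator
coefficients must converge as well: they are read off from the blocks at one point of the polyball,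
a small multiple of the creation operators on the Fock space realised on `H`. -/

noncomputable section
namespace Polyball

/-! ### Positivity of defect maps -/

section Geometry

open Filter Topology

variable {H : Type*} [NormedAddCommGroup H] [InnerProductSpace ℂ H] [CompleteSpace H]

theorem cpMap_apply {m : ℕ} (X : Fin m → (H →L[ℂ] H)) (Y : H →L[ℂ] H) :
    cpMap X Y = ∑ j, X j * Y * star (X j) := by
  simp [cpMap, LinearMap.sum_apply, mul_assoc]

theorem cpMap_mono {m : ℕ} (X : Fin m → (H →L[ℂ] H)) {Y Z : H →L[ℂ] H} (h : Y ≤ Z) :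
    cpMap X Y ≤ cpMap X Z := by
  simp only [cpMap_apply]
  exact Finset.sum_le_sum fun j _ => star_right_conjugate_le_conjugate h _

theorem isSelfAdjoint_cpMap {m : ℕ} (X : Fin m → (H →L[ℂ] H)) {Y : H →L[ℂ] H}
    (hY : IsSelfAdjoint Y) : IsSelfAdjoint (cpMap X Y) := by
  rw [cpMap_apply]
  exact isSelfAdjoint_sum _ fun j _ => hY.conjugate _

theorem cpMap_smul_of_norm {m : ℕ} (X : Fin m → (H →L[ℂ] H)) (z : ℂ) :
    cpMap (z • X) = ((‖z‖ ^ 2 : ℝ) : ℂ) • cpMap X := by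
  ext1 Y
  rw [LinearMap.smul_apply, cpMap_apply, cpMap_apply, Finset.smul_sum]
  refine Finset.sum_congr rfl fun j _ => ?_
  simp only [Pi.smul_apply, star_smul, smul_mul_assoc, mul_smul_comm, smul_smul]
  congr 1
  rw [Complex.ofReal_pow, ← Complex.conj_mul', Complex.star_def]

theorem cpMap_commute {m m' : ℕ} {X : Fin m → (H →L[ℂ] H)} {X' : Fin m' → (H →L[ℂ] H)}
    (h : ∀ p q, Commute (X p) (X' q)) : Commute (cpMap X) (cpMap X') := by
  refine LinearMap.ext fun Y => ?_
  simp only [Module.End.mul_apply, cpMap_apply, Finset.mul_sum, Finset.sum_mul]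
  rw [Finset.sum_comm]
  refine Finset.sum_congr rfl fun q _ => Finset.sum_congr rfl fun p _ => ?_
  have h1 := (h p q).eq
  have h2 := congrArg star h1
  rw [star_mul, star_mul] at h2
  calc X p * (X' q * Y * star (X' q)) * star (X p)
      = (X p * X' q) * Y * (star (X' q) * star (X p)) := by simp only [mul_assoc]
    _ = (X' q * X p) * Y * (star (X p) * star (X' q)) := by rw [h1, h2]
    _ = _ := by simp only [mul_assoc]

/-- The inequality `-Y ≤ Φ(-Y)` can be iterated. Since `Φ(1) ≤ q < 1`, it yields `-Y ≤ ‖Y‖ qⁿ` for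
all `n`, and the right side tends to `0`. -/
theorem nonneg_of_cpMap_le {m : ℕ} {X : Fin m → (H →L[ℂ] H)} (hX : X ∈ openBall m H)
    {Y : H →L[ℂ] H} (hY : IsSelfAdjoint Y) (h : 0 ≤ (1 - cpMap X) Y) : 0 ≤ Y := by
  set q : ℝ := ‖∑ j, X j * star (X j)‖ with hq
  have hq1 : q < 1 := hX
  have hone : cpMap X 1 ≤ algebraMap ℝ _ q := by
    have : cpMap X 1 = ∑ j, X j * star (X j) := by simp [cpMap_apply]
    rw [this]
    exact IsSelfAdjoint.le_algebraMap_norm_self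
      (isSelfAdjoint_sum _ fun j _ => IsSelfAdjoint.mul_star_self _)
  have hle : -Y ≤ cpMap X (-Y) := by
    rw [map_neg, neg_le_neg_iff]
    simpa using h
  have key : ∀ n : ℕ, -Y ≤ algebraMap ℝ (H →L[ℂ] H) (‖Y‖ * q ^ n) := by
    intro n
    induction n with
    | zero =>
      simpa using neg_le.mpr (IsSelfAdjoint.neg_algebraMap_norm_le_self hY)
    | succ n ih =>
      refine hle.trans ((cpMap_mono X ih).trans ?_)
      have e : cpMap X (algebraMap ℝ (H →L[ℂ] H) (‖Y‖ * q ^ n)) = (‖Y‖ * q ^ n) • cpMap X 1 := by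
        rw [Algebra.algebraMap_eq_smul_one, ← Complex.coe_smul, map_smul, Complex.coe_smul]
      rw [e, pow_succ, ← mul_assoc, map_mul, Algebra.algebraMap_eq_smul_one (‖Y‖ * q ^ n),
        smul_one_mul]
      exact smul_le_smul_of_nonneg_left hone (by positivity)
  have hlim : Tendsto (fun n : ℕ => algebraMap ℝ (H →L[ℂ] H) (‖Y‖ * q ^ n)) atTop (𝓝 0) := by
    have h1 : Tendsto (fun n : ℕ => ‖Y‖ * q ^ n) atTop (𝓝 0) := by
      simpa using (tendsto_pow_atTop_nhds_zero_of_lt_one (norm_nonneg _) hq1).const_mul ‖Y‖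
    have h2 := (algebraMapCLM ℝ (H →L[ℂ] H)).continuous.tendsto 0
    rw [map_zero] at h2
    exact h2.comp h1
  simpa using ge_of_tendsto' hlim key

variable {ι : Type*} {n : ι → ℕ} {X : (i : ι) → Fin (n i) → (H →L[ℂ] H)}

theorem isSelfAdjoint_sub_smul_cpMap (i : ι) (s : ℝ) {Y : H →L[ℂ] H} (hY : IsSelfAdjoint Y) :
    IsSelfAdjoint ((1 - (s : ℂ) • cpMap (X i)) Y) := by
  simp only [LinearMap.sub_apply, Module.End.one_apply, LinearMap.smul_apply]
  refine hY.sub ?_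
  rw [Complex.coe_smul]
  exact (IsSelfAdjoint.all s).smul (isSelfAdjoint_cpMap _ hY)

theorem isSelfAdjoint_list_prod_defect (s : ℝ) (L : List ι) {Y : H →L[ℂ] H}
    (hY : IsSelfAdjoint Y) :
    IsSelfAdjoint ((L.map fun i => 1 - (s : ℂ) • cpMap (X i)).prod Y) := by
  induction L with
  | nil => simpa
  | cons a L ih =>
    rw [List.map_cons, List.prod_cons, Module.End.mul_apply]
    exact isSelfAdjoint_sub_smul_cpMap a s ih

theorem nonneg_of_list_prod_defect (hX : ∀ i, X i ∈ openBall (n i) H) (L : List ι)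
    {Y : H →L[ℂ] H} (hY : IsSelfAdjoint Y)
    (h : 0 ≤ (L.map fun i => 1 - cpMap (X i)).prod Y) : 0 ≤ Y := by
  induction L with
  | nil => simpa using h
  | cons a L ih =>
    rw [List.map_cons, List.prod_cons, Module.End.mul_apply] at h
    refine ih (nonneg_of_cpMap_le (hX a) ?_ h)
    simpa using isSelfAdjoint_list_prod_defect (X := X) 1 L hY

/-- Because `1 - sΦ = (1 - s) + s(1 - Φ)`, the product of commuting factors expands into partial
defects with nonnegative coefficients. All partial defects are nonnegative once the full one is, so
the term with only factors `1 - s` is a lower bound. -/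
theorem smul_le_list_prod_defect (hX : ∀ i, X i ∈ openBall (n i) H)
    {s : ℝ} (hs0 : 0 ≤ s) (hs1 : s ≤ 1) (L : List ι) (hL : L.Nodup)
    (hc : ∀ i j, i ≠ j → Commute (cpMap (X i)) (cpMap (X j)))
    {Y : H →L[ℂ] H} (hY : IsSelfAdjoint Y)
    (h : 0 ≤ (L.map fun i => 1 - cpMap (X i)).prod Y) :
    (1 - s) ^ L.length • Y ≤ (L.map fun i => 1 - (s : ℂ) • cpMap (X i)).prod Y := by
  induction L generalizing Y with
  | nil => simp
  | cons a L ih =>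
    obtain ⟨haL, hL'⟩ := List.nodup_cons.mp hL
    have hne : ∀ i ∈ L, a ≠ i := fun i hi hai => haL (hai ▸ hi)
    have c1 : Commute (1 - cpMap (X a)) (L.map fun i => 1 - cpMap (X i)).prod := by
      refine Commute.list_prod_right _ _ fun x hx => ?_
      obtain ⟨i, hi, rfl⟩ := List.mem_map.mp hx
      exact ((Commute.one_left _).sub_left ((Commute.one_right _).sub_right (hc a i (hne i hi))))
    have c2 : Commute (1 - (s : ℂ) • cpMap (X a))
        (L.map fun i => 1 - (s : ℂ) • cpMap (X i)).prod := by
      refine Commute.list_prod_right _ _ fun x hx => ?_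
      obtain ⟨i, hi, rfl⟩ := List.mem_map.mp hx
      exact ((Commute.one_left _).sub_left
        ((Commute.one_right _).sub_right (((hc a i (hne i hi)).smul_left _).smul_right _)))
    rw [List.map_cons, List.prod_cons] at h ⊢
    have hsa : IsSelfAdjoint ((1 - cpMap (X a)) Y) := by
      simpa using isSelfAdjoint_sub_smul_cpMap (X := X) a 1 hY
    have h1 : 0 ≤ (L.map fun i => 1 - cpMap (X i)).prod Y := by
      refine nonneg_of_cpMap_le (hX a) ?_ h
      simpa using isSelfAdjoint_list_prod_defect (X := X) 1 L hY
    have h2 : 0 ≤ (L.map fun i => 1 - cpMap (X i)).prod ((1 - cpMap (X a)) Y) := by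
      rw [← Module.End.mul_apply, ← c1.eq]; exact h
    have i1 := ih hL' hY h1
    have i2 := ih hL' hsa h2
    have h3 : 0 ≤ (1 - cpMap (X a)) Y := nonneg_of_list_prod_defect hX L hsa h2
    have e : (1 - (s : ℂ) • cpMap (X a)) Y = (1 - s) • Y + s • (1 - cpMap (X a)) Y := by
      simp only [LinearMap.sub_apply, Module.End.one_apply, LinearMap.smul_apply, Complex.coe_smul]
      module
    rw [c2.eq, Module.End.mul_apply, e, map_add, LinearMap.map_smul_of_tower,
      LinearMap.map_smul_of_tower, List.length_cons, pow_succ', mul_smul]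
    have h1s : 0 ≤ 1 - s := by linarith
    refine le_trans ?_ (add_le_add (smul_le_smul_of_nonneg_left i1 h1s)
      (smul_le_smul_of_nonneg_left i2 hs0))
    exact le_add_of_nonneg_right (smul_nonneg hs0 (smul_nonneg (pow_nonneg h1s _) h3))

end Geometry

/-! ### Radial structure and openness of the polyball -/

section Polyball

open Filter Topology

variable {H : Type*} [NormedAddCommGroup H] [InnerProductSpace ℂ H] [CompleteSpace H]
variable {k : ℕ} {n : Fin k → ℕ}

theorem defectMap_eq (X : Tuple n H) :
    defectMap X = ((List.finRange k).map fun i => 1 - cpMap (X i)).prod := by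
  rw [defectMap, List.ofFn_eq_map]

theorem defectMap_smul (X : Tuple n H) (r : ℝ) :
    defectMap ((r : ℂ) • X) =
      ((List.finRange k).map fun i => 1 - ((r ^ 2 : ℝ) : ℂ) • cpMap (X i)).prod := by
  rw [defectMap_eq]
  congr 2
  funext i
  rw [Pi.smul_apply, cpMap_smul_of_norm]
  simp

theorem isSelfAdjoint_defectMap (X : Tuple n H) : IsSelfAdjoint (defectMap X 1) := by
  rw [defectMap_eq]
  simpa using isSelfAdjoint_list_prod_defect (X := X) 1 (List.finRange k) (.one _)

theorem continuous_cpMap_apply {T : Type*} [TopologicalSpace T] {m : ℕ}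
    {f : T → Fin m → (H →L[ℂ] H)} {g : T → (H →L[ℂ] H)} (hf : Continuous f) (hg : Continuous g) :
    Continuous fun t => cpMap (f t) (g t) := by
  simp only [cpMap_apply]
  refine continuous_finsetSum _ fun j _ => ?_
  have hj : Continuous fun t => f t j := (continuous_apply j).comp hf
  exact (hj.mul hg).mul hj.star

theorem continuous_defectMap_apply :
    Continuous fun X : Tuple n H => defectMap X (1 : H →L[ℂ] H) := by
  have key : ∀ L : List (Fin k), Continuous fun X : Tuple n H =>
      (L.map fun i => 1 - cpMap (X i)).prod (1 : H →L[ℂ] H) := by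
    intro L
    induction L with
    | nil => simpa using continuous_const
    | cons a L ih =>
      simp only [List.map_cons, List.prod_cons, Module.End.mul_apply, LinearMap.sub_apply,
        Module.End.one_apply]
      exact ih.sub (continuous_cpMap_apply (continuous_apply a) ih)
  simp only [defectMap_eq]
  exact key _

theorem sum_smul_mul_star {m : ℕ} (X : Fin m → (H →L[ℂ] H)) (z : ℂ) :
    ∑ j, (z • X) j * star ((z • X) j) = ((‖z‖ ^ 2 : ℝ) : ℂ) • ∑ j, X j * star (X j) := by
  simpa [cpMap_apply] using congrArg (fun T => T 1) (cpMap_smul_of_norm X z)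

/-- The bound `(1 - r²)^k` for the defect of `rX` depends on `r` only, so it passes from the open
polyball to its norm closure together with commutation and the non-strict row-contraction condition;
the factor `r < 1` then makes the latter strict. -/
theorem smul_mem_openPolyball_of_mem_closedPolyball [Nontrivial H] {X : Tuple n H}
    (hX : X ∈ closedPolyball n H) {r : ℝ} (hr0 : 0 ≤ r) (hr1 : r < 1) :
    (r : ℂ) • X ∈ openPolyball n H := by
  have hr2 : r ^ 2 < 1 := by nlinarith
  have hsub : closedPolyball n H ⊆ {X : Tuple n H |
      (∀ s t, s ≠ t → ∀ p q, X s p * X t q = X t q * X s p) ∧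
      (∀ i, ‖∑ j, X i j * star (X i j)‖ ≤ 1) ∧
      (1 - r ^ 2) ^ k • (1 : H →L[ℂ] H) ≤ defectMap ((r : ℂ) • X) 1} := by
    refine closure_minimal ?_ ?_
    · rintro X ⟨hc, hb, hd⟩
      refine ⟨fun s t hst p q => hc s t hst p q, fun i => le_of_lt (hb i), ?_⟩
      have := smul_le_list_prod_defect hb (sq_nonneg r) hr2.le (List.finRange k)
        (List.nodup_finRange k) (fun i j hij => cpMap_commute (hc i j hij))
        (Y := 1) (.one _) (by rw [← defectMap_eq]; exact hd.nonneg)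
      rwa [List.length_finRange, ← defectMap_smul] at this
    · have hev : ∀ s p, Continuous fun X : Tuple n H => X s p := fun s p => by fun_prop
      have c1 : ∀ s t p q, IsClosed {X : Tuple n H | X s p * X t q = X t q * X s p} :=
        fun s t p q => isClosed_eq ((hev s p).mul (hev t q)) ((hev t q).mul (hev s p))
      have c2 : ∀ i, IsClosed {X : Tuple n H | ‖∑ j, X i j * star (X i j)‖ ≤ 1} := fun i =>
        isClosed_le (continuous_norm.comp (continuous_finsetSum _ fun j _ =>
          (hev i j).mul (hev i j).star)) continuous_const
      have c3 : IsClosed {X : Tuple n H |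
          (1 - r ^ 2) ^ k • (1 : H →L[ℂ] H) ≤ defectMap ((r : ℂ) • X) 1} :=
        isClosed_le continuous_const
          (continuous_defectMap_apply.comp (continuous_const_smul (r : ℂ)))
      simp only [Set.ofPred_and, Set.ofPred_forall]
      exact (isClosed_iInter fun s => isClosed_iInter fun t => isClosed_iInter fun _ =>
        isClosed_iInter fun p => isClosed_iInter fun q => c1 s t p q).inter
        ((isClosed_iInter c2).inter c3)
  obtain ⟨hc, hb, hd⟩ := hsub hX
  refine ⟨fun s t hst p q => Commute.smul_right (Commute.smul_left (hc s t hst p q) (r : ℂ)) (r : ℂ), fun i => ?_, ?_⟩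
  · change ‖∑ j, ((r : ℂ) • X i) j * star (((r : ℂ) • X i) j)‖ < 1
    rw [sum_smul_mul_star, norm_smul]
    have hn : ‖((‖(r : ℂ)‖ ^ 2 : ℝ) : ℂ)‖ = r ^ 2 := by simp
    rw [hn]
    nlinarith [hb i, sq_nonneg r]
  · refine IsStrictlyPositive.of_le ?_ hd
    refine ⟨smul_nonneg (pow_nonneg (by linarith) _) zero_le_one, ?_⟩
    have hne : (1 - r ^ 2) ^ k ≠ 0 := pow_ne_zero _ (by linarith)
    exact isUnit_one.smul (Units.mk0 _ hne)

theorem openPolyball_subset_closedPolyball : openPolyball n H ⊆ closedPolyball n H :=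
  subset_closure

theorem torus_smul_mem_openPolyball {X : Tuple n H} (hX : X ∈ openPolyball n H)
    {z : Fin k → ℂ} (hz : ∀ i, ‖z i‖ = 1) : (fun i => z i • X i : Tuple n H) ∈ openPolyball n H := by
  obtain ⟨hc, hb, hd⟩ := hX
  have e : ∀ i, cpMap (z i • X i) = cpMap (X i) := fun i => by
    rw [cpMap_smul_of_norm, hz i]; simp
  refine ⟨fun s t hst p q => ((hc s t hst p q).smul_left (z s)).smul_right (z t), fun i => ?_, ?_⟩
  · change ‖∑ j, (z i • X i) j * star ((z i • X i) j)‖ < 1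
    rw [sum_smul_mul_star, hz i]
    simpa using (show ‖∑ j, X i j * star (X i j)‖ < 1 from hb i)
  · have : defectMap (fun i => z i • X i : Tuple n H) = defectMap X := by
      simp only [defectMap_eq, e]
    rwa [this]

/-- Strict positivity is open among self-adjoint operators: `a ≥ ε` and `‖D t - a‖ < ε/2` give `D t
≥ ε/2`. -/
theorem IsStrictlyPositive.eventually_of_tendsto [Nontrivial H] {T : Type*} {l : Filter T}
    {D : T → (H →L[ℂ] H)} {a : H →L[ℂ] H} (hD : ∀ t, IsSelfAdjoint (D t))
    (hlim : Tendsto D l (𝓝 a)) (ha : IsStrictlyPositive a) :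
    ∀ᶠ t in l, IsStrictlyPositive (D t) := by
  have hsa : IsSelfAdjoint a := .of_nonneg ha.nonneg
  obtain ⟨ε, hε, hle⟩ := (CFC.exists_pos_algebraMap_le_iff hsa).2 fun x hx => ha.spectrum_pos hx
  filter_upwards [Metric.tendsto_nhds.mp hlim (ε / 2) (by positivity)] with t ht
  rw [dist_eq_norm] at ht
  have h1 : -algebraMap ℝ (H →L[ℂ] H) (ε / 2) ≤ D t - a :=
    le_trans (neg_le_neg (algebraMap_mono _ ht.le))
      (IsSelfAdjoint.neg_algebraMap_norm_le_self ((hD t).sub hsa))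
  have h2 : algebraMap ℝ (H →L[ℂ] H) (ε / 2) ≤ D t := by
    have h3 := add_le_add h1 hle
    rw [sub_add_cancel, ← map_neg, ← map_add] at h3
    convert h3 using 2
    ring
  refine IsStrictlyPositive.of_le ⟨?_, ?_⟩ h2
  · rw [Algebra.algebraMap_eq_smul_one]
    exact smul_nonneg (by positivity) zero_le_one
  · exact (Units.mk0 (ε / 2) (by positivity)).isUnit.map _

theorem eventually_smul_mem_openPolyball [Nontrivial H] {X : Tuple n H}
    (hc : ∀ s t, s ≠ t → ∀ p q, Commute (X s p) (X t q)) {t₀ : ℝ}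
    (h₀ : (t₀ : ℂ) • X ∈ openPolyball n H) :
    ∀ᶠ t : ℝ in 𝓝 t₀, (t : ℂ) • X ∈ openPolyball n H := by
  have hcont : Continuous fun t : ℝ => (t : ℂ) • X :=
    Complex.continuous_ofReal.smul continuous_const
  have h1 := IsStrictlyPositive.eventually_of_tendsto
    (fun t : ℝ => isSelfAdjoint_defectMap ((t : ℂ) • X))
    ((continuous_defectMap_apply.comp hcont).tendsto t₀) h₀.2.2
  have h2 : ∀ i, ∀ᶠ t : ℝ in 𝓝 t₀, ((t : ℂ) • X) i ∈ openBall (n i) H := by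
    intro i
    have hci : Continuous fun t : ℝ =>
        ‖∑ j, ((t : ℂ) • X) i j * star (((t : ℂ) • X) i j)‖ := by
      refine continuous_norm.comp (continuous_finsetSum _ fun j _ => ?_)
      have : Continuous fun t : ℝ => ((t : ℂ) • X) i j :=
        (continuous_apply j).comp ((continuous_apply i).comp hcont)
      exact this.mul this.star
    exact hci.tendsto t₀ (gt_mem_nhds (h₀.2.1 i))
  filter_upwards [h1, eventually_all.mpr h2] with t ht1 ht2
  exact ⟨fun i j hij p q => ((hc i j hij p q).smul_left (t : ℂ)).smul_right (t : ℂ), ht2, ht1⟩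

theorem zero_mem_openPolyball : (0 : Tuple n H) ∈ openPolyball n H := by
  refine ⟨fun s t _ p q => Commute.zero_left _, fun i => by simp [openBall], ?_⟩
  have : defectMap (0 : Tuple n H) = 1 := by
    rw [defectMap_eq]
    refine List.prod_eq_one fun x hx => ?_
    obtain ⟨i, -, rfl⟩ := List.mem_map.mp hx
    ext1 Y
    simp [cpMap_apply]
  rw [this]
  exact ⟨zero_le_one, isUnit_one⟩

theorem exists_pos_smul_mem_openPolyball [Nontrivial H] {X : Tuple n H}
    (hc : ∀ s t, s ≠ t → ∀ p q, Commute (X s p) (X t q)) :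
    ∃ t : ℝ, 0 < t ∧ (t : ℂ) • X ∈ openPolyball n H := by
  have h0 : ((0 : ℝ) : ℂ) • X ∈ openPolyball n H := by simpa using zero_mem_openPolyball
  obtain ⟨t, ht, htpos⟩ := (((eventually_smul_mem_openPolyball hc h0).filter_mono
    nhdsWithin_le_nhds).and (self_mem_nhdsWithin : Set.Ioi (0 : ℝ) ∈ 𝓝[>] 0)).exists
  exact ⟨t, htpos, ht⟩

/-- The conditions other than commutation are open along the ray through `X`, so `X` can be enlarged
slightly. The gained factor `ρ < 1` is the source of every geometric decay below. -/
theorem exists_eq_smul_of_mem_openPolyball [Nontrivial H] {X : Tuple n H}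
    (hX : X ∈ openPolyball n H) :
    ∃ ρ : ℝ, 0 < ρ ∧ ρ < 1 ∧ ∃ X' ∈ openPolyball n H, X = (ρ : ℂ) • X' := by
  have h1 : ((1 : ℝ) : ℂ) • X ∈ openPolyball n H := by simpa using hX
  obtain ⟨t, ht, htpos⟩ := (((eventually_smul_mem_openPolyball hX.1 h1).filter_mono
    nhdsWithin_le_nhds).and (self_mem_nhdsWithin : Set.Ioi (1 : ℝ) ∈ 𝓝[>] 1)).exists
  have ht1 : 1 < t := htpos
  have ht0 : (t : ℂ) ≠ 0 := by exact_mod_cast (by linarith : t ≠ 0)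
  refine ⟨t⁻¹, by positivity, inv_lt_one_of_one_lt₀ ht1, (t : ℂ) • X, ht, ?_⟩
  rw [smul_smul, Complex.ofReal_inv, inv_mul_cancel₀ ht0, one_smul]

theorem exists_eq_smul_of_mem_openBall {m : ℕ} {X : Fin m → (H →L[ℂ] H)}
    (hX : X ∈ openBall m H) :
    ∃ ρ : ℝ, 0 < ρ ∧ ρ < 1 ∧ ∃ X' ∈ openBall m H, X = (ρ : ℂ) • X' := by
  have hcont : ContinuousAt (fun t : ℝ => t ^ 2 * ‖∑ j, X j * star (X j)‖) 1 := by fun_prop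
  have hlt : (1 : ℝ) ^ 2 * ‖∑ j, X j * star (X j)‖ < 1 := by
    rw [one_pow, one_mul]; exact hX
  obtain ⟨t, ht, htpos⟩ := (((hcont.eventually_lt continuousAt_const hlt).filter_mono
    nhdsWithin_le_nhds).and (self_mem_nhdsWithin : Set.Ioi (1 : ℝ) ∈ 𝓝[>] 1)).exists
  have ht1 : 1 < t := htpos
  have ht0 : (t : ℂ) ≠ 0 := by exact_mod_cast (by linarith : t ≠ 0)
  refine ⟨t⁻¹, by positivity, inv_lt_one_of_one_lt₀ ht1, (t : ℂ) • X, ?_, ?_⟩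
  · change ‖∑ j, ((t : ℂ) • X) j * star (((t : ℂ) • X) j)‖ < 1
    rw [sum_smul_mul_star, norm_smul]
    simpa using ht
  · rw [smul_smul, Complex.ofReal_inv, inv_mul_cancel₀ ht0, one_smul]

end Polyball

end Polyball
end

noncomputable section
namespace Polyball

/-! ### Ordered products of absolutely convergent series -/

section ProductSums

theorem hasSum_of_eq {α β : Type*} [AddCommMonoid α] [TopologicalSpace α] {f g : β → α} {a : α}
    (h : HasSum g a) (e : ∀ x, f x = g x) : HasSum f a := by
  rwa [show f = g from funext e]

/-- Absolute summability is proved along with the sum, since the induction multiplies the first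
series by the product of the remaining ones. -/
theorem hasSum_list_ofFn_prod {R : Type*} [NormedRing R] [CompleteSpace R] {k : ℕ}
    {ι : Fin k → Type*} (f : ∀ i, ι i → R) (hf : ∀ i, Summable fun x => ‖f i x‖) :
    (Summable fun x : ∀ i, ι i => ‖(List.ofFn fun i => f i (x i)).prod‖) ∧
      HasSum (fun x : ∀ i, ι i => (List.ofFn fun i => f i (x i)).prod)
        (List.ofFn fun i => ∑' x, f i x).prod := by
  induction k with
  | zero =>
    simp only [List.ofFn_zero, List.prod_nil]
    refine ⟨(hasSum_unique _).summable, ?_⟩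
    exact hasSum_unique (fun _ : ∀ i, ι i => (1 : R))
  | succ k ih =>
    obtain ⟨h1, h2⟩ := ih (fun i => f i.succ) fun i => hf i.succ
    have e : ∀ x : ι 0 × (∀ i : Fin k, ι i.succ),
        (List.ofFn fun i => f i (Fin.consEquiv ι x i)).prod =
          f 0 x.1 * (List.ofFn fun i => f i.succ (x.2 i)).prod := by
      intro x
      rw [List.ofFn_succ, List.prod_cons]
      rfl
    constructor
    · refine (Fin.consEquiv ι).summable_iff.mp ?_
      exact ((hf 0).mul_norm h1).congr fun x => congrArg norm (e x).symm
    · have h3 := (summable_mul_of_summable_norm (hf 0) h1).hasSum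
      rw [← tsum_mul_tsum_of_summable_norm (hf 0) h1, h2.tsum_eq] at h3
      have e' : (List.ofFn fun i => ∑' x, f i x).prod =
          (∑' x, f 0 x) * (List.ofFn fun i : Fin k => ∑' x, f i.succ x).prod := by
        rw [List.ofFn_succ, List.prod_cons]
      rw [e']
      exact (Fin.consEquiv ι).hasSum_iff.mp (hasSum_of_eq h3 e)

theorem list_ofFn_prod_sum {R : Type*} [NormedRing R] [CompleteSpace R] {k : ℕ}
    {ι : Fin k → Type*} [∀ i, Fintype (ι i)] (f : ∀ i, ι i → R) :
    (List.ofFn fun i => ∑ x, f i x).prod =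
      ∑ x : ∀ i, ι i, (List.ofFn fun i => f i (x i)).prod := by
  have h := (hasSum_list_ofFn_prod f fun i => (hasSum_fintype _).summable).2
  simp only [tsum_fintype] at h
  exact h.unique (hasSum_fintype _)

end ProductSums

/-! ### Fourier series and Harnack inequalities on the torus -/

section Torus

open MeasureTheory UnitAddTorus AddCircle

variable {k : ℕ}

/-- The normalized Haar measure on the torus `(ℝ/ℤ)^k`. -/
def torusMeasure (k : ℕ) : Measure (UnitAddTorus (Fin k)) :=
  Measure.pi fun _ => haarAddCircle

instance : IsProbabilityMeasure (torusMeasure k) := by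
  unfold torusMeasure; infer_instance

theorem integral_mFourier (m : Fin k → ℤ) :
    ∫ t, mFourier m t ∂torusMeasure k = if m = 0 then 1 else 0 := by
  have h1 : ∀ n : ℤ, ∫ x : UnitAddCircle, fourier n x ∂haarAddCircle = if n = 0 then 1 else 0 := by
    intro n
    have h := congrFun (fourierCoeff_fourier (T := 1) n) 0
    simp only [fourierCoeff, neg_zero, fourier_zero, one_smul, Pi.single_apply, eq_comm] at h
    exact h.symm
  simp only [mFourier, ContinuousMap.coe_mk, torusMeasure]
  rw [integral_fintype_prod_eq_prod (fun i (x : UnitAddCircle) => (fourier (m i) x : ℂ))]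
  simp only [h1]
  split_ifs with h
  · simp [h]
  · obtain ⟨i, hi⟩ := Function.ne_iff.mp h
    exact Finset.prod_eq_zero (Finset.mem_univ i) (if_neg hi)

theorem norm_fourier_apply (n : ℤ) (x : UnitAddCircle) : ‖(fourier n x : ℂ)‖ = 1 := by
  rw [fourier_apply]
  exact Circle.norm_coe _

theorem norm_mFourier_apply (m : Fin k → ℤ) (t : UnitAddTorus (Fin k)) : ‖mFourier m t‖ = 1 := by
  simp only [mFourier, ContinuousMap.coe_mk, norm_prod, norm_fourier_apply, Finset.prod_const_one]

variable {a : (Fin k → ℤ) → ℂ} {f : UnitAddTorus (Fin k) → ℂ}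

theorem continuous_of_hasSum_mFourier (ha : Summable a)
    (hf : ∀ t, HasSum (fun m => a m * mFourier m t) (f t)) : Continuous f := by
  have : f = fun t => ∑' m, a m * mFourier m t := funext fun t => (hf t).tsum_eq.symm
  rw [this]
  refine continuous_tsum (u := fun m => ‖a m‖) (fun m => by fun_prop) ha.norm fun m t => ?_
  rw [norm_mul, norm_mFourier_apply, mul_one]

/-- Taking `g` a character extracts a Fourier coefficient; taking `f` the Poisson kernel gives the
Poisson integral of `g`. -/
theorem hasSum_integral_mul_mFourier (ha : Summable a)
    (hf : ∀ t, HasSum (fun m => a m * mFourier m t) (f t)) {g : UnitAddTorus (Fin k) → ℂ}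
    (hg : Continuous g) :
    HasSum (fun m => a m * ∫ t, g t * mFourier m t ∂torusMeasure k)
      (∫ t, g t * f t ∂torusMeasure k) := by
  obtain ⟨C, hC⟩ : ∃ C, ∀ t, ‖g t‖ ≤ C := by
    obtain ⟨C, hC⟩ := isCompact_univ.exists_bound_of_continuousOn hg.continuousOn
    exact ⟨C, fun t => hC t trivial⟩
  have hint : ∀ m : Fin k → ℤ, Integrable (fun t => a m * (g t * mFourier m t)) (torusMeasure k) :=
    fun m => (by fun_prop : Continuous fun t => a m * (g t * mFourier m t)).integrable_of_hasCompactSupport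
      (HasCompactSupport.of_compactSpace _)
  have h := hasSum_integral_of_summable_integral_norm hint (by
    refine Summable.of_nonneg_of_le (fun m => integral_nonneg fun t => norm_nonneg _) (fun m => ?_)
      (ha.norm.mul_right C)
    refine (integral_mono_of_nonneg (.of_forall fun t => norm_nonneg _)
      (integrable_const (‖a m‖ * C)) (.of_forall fun t => ?_)).trans (by simp)
    simp only [norm_mul, norm_mFourier_apply, mul_one]
    exact mul_le_mul_of_nonneg_left (hC t) (norm_nonneg _))
  simp only [integral_const_mul] at h
  convert! h using 2
  funext t
  refine ((hf t).mul_left (g t)).tsum_eq.symm.trans (tsum_congr fun m => by ring)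

theorem integral_mFourier_neg_mul (ha : Summable a)
    (hf : ∀ t, HasSum (fun m => a m * mFourier m t) (f t)) (n : Fin k → ℤ) :
    ∫ t, mFourier (-n) t * f t ∂torusMeasure k = a n := by
  have h := hasSum_integral_mul_mFourier ha hf (mFourier (-n)).continuous
  simp only [← mFourier_add, integral_mFourier, neg_add_eq_zero, mul_ite, mul_one, mul_zero] at h
  refine h.unique ?_
  have := hasSum_single (f := fun m => if n = m then a m else 0) n fun m hm => if_neg hm.symm
  simpa using this

theorem norm_fourierCoeff_le (ha : Summable a)
    (hf : ∀ t, HasSum (fun m => a m * mFourier m t) (f t)) {C : ℝ} (hC : ∀ t, ‖f t‖ ≤ C)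
    (n : Fin k → ℤ) : ‖a n‖ ≤ C := by
  rw [← integral_mFourier_neg_mul ha hf n]
  refine (norm_integral_le_of_norm_le_const (C := C) (.of_forall fun t => ?_)).trans (by simp)
  rw [norm_mul, norm_mFourier_apply, one_mul]
  exact hC t

variable {g : UnitAddTorus (Fin k) → ℝ}

theorem fourierCoeff_zero_of_real (ha : Summable a)
    (hf : ∀ t, HasSum (fun m => a m * mFourier m t) (g t : ℂ)) :
    ((∫ t, g t ∂torusMeasure k : ℝ) : ℂ) = a 0 := by
  have h := integral_mFourier_neg_mul ha hf 0
  simp only [neg_zero, mFourier_zero, ContinuousMap.one_apply, one_mul] at h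
  rw [← h]
  exact integral_ofReal.symm

/-- A coefficient is at most `∫ |g|`, which for `g ≥ 0` equals `∫ g = a 0`. -/
theorem norm_fourierCoeff_le_of_nonneg (ha : Summable a)
    (hf : ∀ t, HasSum (fun m => a m * mFourier m t) (g t : ℂ)) (hg : ∀ t, 0 ≤ g t)
    (n : Fin k → ℤ) : ‖a n‖ ≤ (a 0).re := by
  rw [← integral_mFourier_neg_mul ha hf n, ← fourierCoeff_zero_of_real ha hf, Complex.ofReal_re]
  refine (norm_integral_le_integral_norm _).trans (le_of_eq (integral_congr_ae
    (.of_forall fun t => ?_)))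
  simp [norm_mFourier_apply, abs_of_nonneg (hg t)]

theorem hasSum_poisson {ρ : ℝ} (h0 : 0 ≤ ρ) (h1 : ρ < 1) (x : UnitAddCircle) :
    HasSum (fun n : ℤ => ((ρ ^ n.natAbs : ℝ) : ℂ) * fourier n x)
      (((1 - ρ ^ 2) / ‖1 - ρ * (fourier 1 x : ℂ)‖ ^ 2 : ℝ) : ℂ) := by
  set z : ℂ := fourier 1 x with hz
  have hz1 : ‖z‖ = 1 := norm_fourier_apply 1 x
  have hpow : ∀ n : ℕ, (fourier (n : ℤ) x : ℂ) = z ^ n := by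
    intro n
    induction n with
    | zero => simp
    | succ n ih => rw [Nat.cast_succ, fourier_add, ih, pow_succ]
  have hn : ‖(ρ : ℂ) * z‖ < 1 := by simp [hz1, abs_of_nonneg h0, h1]
  have hn' : ‖(ρ : ℂ) * star z‖ < 1 := by simp [hz1, abs_of_nonneg h0, h1]
  have s1 := hasSum_geometric_of_norm_lt_one hn
  have s2 := (hasSum_geometric_of_norm_lt_one hn').mul_left ((ρ : ℂ) * star z)
  have hne : (1 - (ρ : ℂ) * z) ≠ 0 := fun h => by
    rw [sub_eq_zero] at h; rw [← h] at hn; simp at hn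
  have hne' : (1 - (ρ : ℂ) * star z) ≠ 0 := fun h => by
    rw [sub_eq_zero] at h; rw [← h] at hn'; simp at hn'
  -- The frequencies `n ≥ 0` and `n ≤ -1` form two geometric series, with ratios `ρz` and `ρ z̄`;
  -- `|z| = 1` collapses their sum to the Poisson kernel.
  have key := HasSum.of_nat_of_neg_add_one
    (f := fun n : ℤ => ((ρ ^ n.natAbs : ℝ) : ℂ) * fourier n x)
    (m := (1 - (ρ : ℂ) * z)⁻¹) (m' := (ρ : ℂ) * star z * (1 - (ρ : ℂ) * star z)⁻¹) ?_ ?_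
  · convert key using 1
    have hzz : z * star z = 1 := by
      rw [Complex.star_def, Complex.mul_conj, Complex.normSq_eq_norm_sq, hz1]; simp
    have hsq : ((‖1 - (ρ : ℂ) * z‖ ^ 2 : ℝ) : ℂ) = (1 - (ρ : ℂ) * z) * (1 - (ρ : ℂ) * star z) := by
      rw [← Complex.normSq_eq_norm_sq, ← Complex.mul_conj]; simp
    rw [Complex.ofReal_div, hsq]
    field_simp
    push_cast
    linear_combination ((ρ : ℂ) ^ 2) * hzz
  · refine hasSum_of_eq s1 fun n => ?_
    rw [hpow, mul_pow]
    simp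
  · refine hasSum_of_eq s2 fun n => ?_
    rw [← pow_succ', mul_pow, fourier_neg, show ((n : ℤ) + 1) = ((n + 1 : ℕ) : ℤ) by simp, hpow,
      show (-((n + 1 : ℕ) : ℤ)).natAbs = n + 1 by omega]
    simp

theorem poisson_lower_bound {ρ : ℝ} (h0 : 0 ≤ ρ) (h1 : ρ < 1) (x : UnitAddCircle) :
    (1 - ρ) / (1 + ρ) ≤ (1 - ρ ^ 2) / ‖1 - ρ * (fourier 1 x : ℂ)‖ ^ 2 := by
  have hz1 : ‖(fourier 1 x : ℂ)‖ = 1 := norm_fourier_apply 1 x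
  have hu : ‖1 - ρ * (fourier 1 x : ℂ)‖ ≤ 1 + ρ := by
    refine (norm_sub_le _ _).trans (le_of_eq ?_)
    rw [norm_mul, hz1, norm_one, Complex.norm_of_nonneg h0, mul_one]
  have hl : 0 < ‖1 - ρ * (fourier 1 x : ℂ)‖ := by
    refine norm_pos_iff.mpr fun h => ?_
    rw [sub_eq_zero] at h
    have := congrArg norm h
    rw [norm_mul, hz1, norm_one, Complex.norm_of_nonneg h0, mul_one] at this
    linarith
  rw [div_le_div_iff₀ (by linarith) (by positivity)]
  have : ‖1 - ρ * (fourier 1 x : ℂ)‖ ^ 2 ≤ (1 + ρ) ^ 2 := by gcongr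
  nlinarith

/-- The weight `ρ^{|m₁| + ⋯ + |m_k|}`. -/
def absWeight (ρ : ℝ) (m : Fin k → ℤ) : ℝ := ∏ i, ρ ^ (m i).natAbs

theorem absWeight_nonneg {ρ : ℝ} (h0 : 0 ≤ ρ) (m : Fin k → ℤ) : 0 ≤ absWeight ρ m :=
  Finset.prod_nonneg fun _ _ => pow_nonneg h0 _

theorem absWeight_le_one {ρ : ℝ} (h0 : 0 ≤ ρ) (h1 : ρ ≤ 1) (m : Fin k → ℤ) :
    absWeight ρ m ≤ 1 :=
  Finset.prod_le_one (fun _ _ => pow_nonneg h0 _) fun _ _ => pow_le_one₀ h0 h1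

theorem absWeight_neg (ρ : ℝ) (m : Fin k → ℤ) : absWeight ρ (-m) = absWeight ρ m := by
  simp [absWeight]

theorem summable_pow_natAbs {ρ : ℝ} (h0 : 0 ≤ ρ) (h1 : ρ < 1) :
    Summable fun n : ℤ => ρ ^ n.natAbs := by
  have h := (hasSum_poisson h0 h1 0).summable
  simp only [fourier_eval_zero, mul_one] at h
  exact_mod_cast h

theorem summable_absWeight {ρ : ℝ} (h0 : 0 ≤ ρ) (h1 : ρ < 1) :
    Summable (absWeight (k := k) ρ) := by
  have h := (hasSum_list_ofFn_prod (fun (_ : Fin k) (n : ℤ) => ρ ^ n.natAbs)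
    fun i => (summable_pow_natAbs h0 h1).norm).2.summable
  refine h.congr fun m => ?_
  rw [absWeight, List.prod_ofFn]

theorem hasSum_poisson_prod {ρ : ℝ} (h0 : 0 ≤ ρ) (h1 : ρ < 1) (t : UnitAddTorus (Fin k)) :
    HasSum (fun n : Fin k → ℤ => (absWeight ρ n : ℂ) * mFourier n t)
      ((∏ i, (1 - ρ ^ 2) / ‖1 - ρ * (fourier 1 (t i) : ℂ)‖ ^ 2 : ℝ) : ℂ) := by
  have h := (hasSum_list_ofFn_prod
    (fun (i : Fin k) (n : ℤ) => ((ρ ^ n.natAbs : ℝ) : ℂ) * fourier n (t i)) fun i =>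
      (summable_pow_natAbs h0 h1).abs.congr fun n => by
        rw [norm_mul, norm_fourier_apply, mul_one, Complex.norm_real, Real.norm_eq_abs]).2
  simp only [List.prod_ofFn, (hasSum_poisson h0 h1 _).tsum_eq, Finset.prod_mul_distrib] at h
  rw [Complex.ofReal_prod]
  refine hasSum_of_eq h fun n => ?_
  rw [absWeight, Complex.ofReal_prod]
  rfl

theorem harnack_upper (ha : Summable a)
    (hf : ∀ t, HasSum (fun m => a m * mFourier m t) (g t : ℂ)) (hg : ∀ t, 0 ≤ g t)
    {ρ : ℝ} (h0 : 0 ≤ ρ) (h1 : ρ < 1) :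
    (∑' m, (absWeight ρ m : ℂ) * a m).re ≤ (∑' m : Fin k → ℤ, absWeight ρ m) * (a 0).re := by
  refine (Complex.re_le_norm _).trans ?_
  rw [← tsum_mul_right]
  refine tsum_of_norm_bounded ((summable_absWeight h0 h1).mul_right _).hasSum fun m => ?_
  rw [norm_mul, Complex.norm_of_nonneg (absWeight_nonneg h0 m)]
  exact mul_le_mul_of_nonneg_left (norm_fourierCoeff_le_of_nonneg ha hf hg m)
    (absWeight_nonneg h0 m)

/-- The damped series is the integral of `g` against the product Poisson kernel, and each of the `k`
factors of that kernel is at least `(1 - ρ)/(1 + ρ)`. -/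
theorem harnack_lower (ha : Summable a)
    (hf : ∀ t, HasSum (fun m => a m * mFourier m t) (g t : ℂ)) (hg : ∀ t, 0 ≤ g t)
    {ρ : ℝ} (h0 : 0 ≤ ρ) (h1 : ρ < 1) :
    ((1 - ρ) / (1 + ρ)) ^ k * (a 0).re ≤ (∑' m, (absWeight ρ m : ℂ) * a m).re := by
  have hw : Summable fun m : Fin k → ℤ => (absWeight ρ m : ℂ) := by
    exact_mod_cast summable_absWeight h0 h1
  set P : UnitAddTorus (Fin k) → ℝ := fun t =>
    ∏ i, (1 - ρ ^ 2) / ‖1 - ρ * (fourier 1 (t i) : ℂ)‖ ^ 2 with hP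
  have hPs : ∀ t, HasSum (fun m => (absWeight ρ m : ℂ) * mFourier m t) (P t : ℂ) :=
    hasSum_poisson_prod h0 h1
  have hgc' : Continuous fun t => (g t : ℂ) := continuous_of_hasSum_mFourier ha hf
  have hgc : Continuous g := Complex.continuous_re.comp hgc'
  have hPc : Continuous P :=
    Complex.continuous_re.comp (continuous_of_hasSum_mFourier hw hPs)
  have h := hasSum_integral_mul_mFourier hw hPs hgc'
  have e : ∑' m, (absWeight ρ m : ℂ) * a m = ∫ t, (g t : ℂ) * P t ∂torusMeasure k := by
    -- Integrating `g` against the character of index `m` gives the coefficient of index `-m`; the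
    -- weight is even, so reindexing by negation matches the two sums.
    rw [← h.tsum_eq, ← (Equiv.neg (Fin k → ℤ)).tsum_eq]
    refine tsum_congr fun m => ?_
    rw [Equiv.neg_apply, absWeight_neg, ← integral_mFourier_neg_mul ha hf (-m), neg_neg]
    simp only [mul_comm]
  have e' : (∑' m, (absWeight ρ m : ℂ) * a m).re = ∫ t, g t * P t ∂torusMeasure k := by
    rw [e, show (∫ t, (g t : ℂ) * P t ∂torusMeasure k) =
      ((∫ t, g t * P t ∂torusMeasure k : ℝ) : ℂ) by
        simp only [← Complex.ofReal_mul]; exact integral_ofReal, Complex.ofReal_re]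
  rw [e', ← fourierCoeff_zero_of_real ha hf, Complex.ofReal_re, ← integral_const_mul]
  have hcs : ∀ {u : UnitAddTorus (Fin k) → ℝ}, Continuous u → Integrable u (torusMeasure k) :=
    fun hu => hu.integrable_of_hasCompactSupport (HasCompactSupport.of_compactSpace _)
  refine integral_mono (hcs (by fun_prop)) (hcs (hgc.mul hPc)) fun t => ?_
  have hle : ((1 - ρ) / (1 + ρ)) ^ k ≤ P t := by
    calc ((1 - ρ) / (1 + ρ)) ^ k = ∏ _i : Fin k, (1 - ρ) / (1 + ρ) := by
          rw [Finset.prod_const, Finset.card_univ, Fintype.card_fin]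
      _ ≤ P t := Finset.prod_le_prod
        (fun _ _ => div_nonneg (by linarith) (by linarith))
        fun i _ => poisson_lower_bound h0 h1 (t i)
  calc ((1 - ρ) / (1 + ρ)) ^ k * g t ≤ P t * g t := mul_le_mul_of_nonneg_right hle (hg t)
    _ = g t * P t := mul_comm _ _

end Torus

end Polyball
end

noncomputable section
namespace Polyball

/-! ### Order and norm through quadratic forms -/

section Operators

variable {K : Type*} [NormedAddCommGroup K] [InnerProductSpace ℂ K]

theorem le_of_re_inner_le [CompleteSpace K] {S T : K →L[ℂ] K} (hS : IsSelfAdjoint S) (hT : IsSelfAdjoint T)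
    (h : ∀ x, (inner ℂ x (S x)).re ≤ (inner ℂ x (T x)).re) : S ≤ T := by
  rw [ContinuousLinearMap.le_def, ContinuousLinearMap.isPositive_def']
  refine ⟨hT.sub hS, fun x => ?_⟩
  have h1 : RCLike.re (inner ℂ ((T - S) x) x) = (inner ℂ x ((T - S) x)).re := by
    rw [← inner_re_symm]; rfl
  rw [ContinuousLinearMap.reApplyInnerSelf_apply, h1, sub_apply, inner_sub_right,
    Complex.sub_re]
  linarith [h x]

theorem inner_eq_re_of_nonneg {T : K →L[ℂ] K} (hT : 0 ≤ T) (x : K) :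
    inner ℂ x (T x) = ((inner ℂ x (T x)).re : ℂ) ∧ 0 ≤ (inner ℂ x (T x)).re := by
  have h := ((ContinuousLinearMap.nonneg_iff_isPositive T).mp hT).inner_nonneg_right x
  rw [Complex.le_def] at h
  refine ⟨Complex.ext rfl ?_, h.1⟩
  simpa using h.2.symm

theorem re_inner_le_of_le {S T : K →L[ℂ] K} (h : S ≤ T) (x : K) :
    (inner ℂ x (S x)).re ≤ (inner ℂ x (T x)).re := by
  have := (inner_eq_re_of_nonneg ((ContinuousLinearMap.nonneg_iff_isPositive _).mpr
    ((ContinuousLinearMap.le_def _ _).mp h)) x).2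
  rw [sub_apply, inner_sub_right, Complex.sub_re] at this
  linarith

/-- Polarization writes `⟪T y, x⟫` for unit vectors as a quarter of four diagonal terms at vectors
of norm at most `2`, each at most `4C`. The crude constant is enough, since only a uniform bound is
needed. -/
theorem norm_le_of_numericalRadius_le {T : K →L[ℂ] K} {C : ℝ} (hC : 0 ≤ C)
    (h : ∀ x, ‖inner ℂ x (T x)‖ ≤ C * ‖x‖ ^ 2) : ‖T‖ ≤ 4 * C := by
  have h' : ∀ x, ‖inner ℂ (T x) x‖ ≤ C * ‖x‖ ^ 2 := fun x => by
    rw [norm_inner_symm]; exact h x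
  have unit : ∀ x y : K, ‖x‖ = 1 → ‖y‖ = 1 → ‖inner ℂ (T y) x‖ ≤ 4 * C := by
    intro x y hx hy
    have hb : ∀ v : K, ‖v‖ ≤ 2 → ‖inner ℂ (T v) v‖ ≤ 4 * C := by
      intro v hv
      have : ‖v‖ ^ 2 ≤ 2 ^ 2 := by gcongr
      nlinarith [h' v]
    have hI : ‖Complex.I • y‖ = 1 := by rw [norm_smul, Complex.norm_I, hy, one_mul]
    have b1 := hb (x + y) ((norm_add_le _ _).trans (by rw [hx, hy]; norm_num))
    have b2 := hb (x - y) ((norm_sub_le _ _).trans (by rw [hx, hy]; norm_num))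
    have b3 := hb (x + Complex.I • y) ((norm_add_le _ _).trans (by rw [hx, hI]; norm_num))
    have b4 := hb (x - Complex.I • y) ((norm_sub_le _ _).trans (by rw [hx, hI]; norm_num))
    have hp := inner_map_polarization (T : K →ₗ[ℂ] K) x y
    simp only [ContinuousLinearMap.coe_coe] at hp
    rw [hp, norm_div]
    set p1 := inner ℂ (T (x + y)) (x + y)
    set p2 := inner ℂ (T (x - y)) (x - y)
    set p3 := inner ℂ (T (x + Complex.I • y)) (x + Complex.I • y)
    set p4 := inner ℂ (T (x - Complex.I • y)) (x - Complex.I • y)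
    have : ‖p1 - p2 + Complex.I * p3 - Complex.I * p4‖ ≤ ‖p1‖ + ‖p2‖ + ‖p3‖ + ‖p4‖ := by
      refine (norm_sub_le _ _).trans ?_
      rw [norm_mul, Complex.norm_I, one_mul]
      gcongr
      refine (norm_add_le _ _).trans ?_
      rw [norm_mul, Complex.norm_I, one_mul]
      gcongr
      exact norm_sub_le _ _
    rw [div_le_iff₀ (by norm_num)]
    norm_num
    linarith
  refine ContinuousLinearMap.opNorm_le_of_unit_norm (𝕜 := ℂ) (by positivity) fun y hy => ?_
  rcases eq_or_ne (T y) 0 with h0 | h0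
  · rw [h0, norm_zero]; positivity
  · have hx : ‖((‖T y‖⁻¹ : ℝ) : ℂ) • T y‖ = 1 := by
      rw [norm_smul, Complex.norm_real, norm_inv, norm_norm, inv_mul_cancel₀ (norm_ne_zero_iff.mpr h0)]
    have := unit _ y hx hy
    rw [inner_smul_right, inner_self_eq_norm_sq_to_K, norm_mul] at this
    have hn : ‖((‖T y‖⁻¹ : ℝ) : ℂ)‖ * ‖((‖T y‖ : ℂ)) ^ 2‖ = ‖T y‖ := by
      rw [Complex.norm_real, norm_inv, norm_norm, norm_pow, Complex.norm_real, norm_norm]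
      field_simp
    exact le_of_eq_of_le hn.symm this

/-- The continuous linear functional `T ↦ ⟪x, T y⟫`. -/
def matrixCoeff (x y : K) : (K →L[ℂ] K) →L[ℂ] ℂ :=
  (innerSL ℂ x).comp (ContinuousLinearMap.apply ℂ K y)

theorem matrixCoeff_apply (x y : K) (T : K →L[ℂ] K) : matrixCoeff x y T = inner ℂ x (T y) := rfl

end Operators

/-! ### Operators on the Hilbert space tensor product -/

section OpTensor

variable {E H : Type*} [NormedAddCommGroup E] [InnerProductSpace ℂ E]
  [NormedAddCommGroup H] [InnerProductSpace ℂ H]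

theorem opTensor_coe (A : E →L[ℂ] E) (T : H →L[ℂ] H) (x : E ⊗[ℂ] H) :
    opTensor A T (x : HilbertTensor E H) = ((TensorProduct.mapL A T x : E ⊗[ℂ] H) :
      HilbertTensor E H) :=
  ContinuousLinearMap.completion_apply_coe _ _

theorem hilbertTensor_clm_ext {S T : HilbertTensor E H →L[ℂ] HilbertTensor E H}
    (h : ∀ x : E ⊗[ℂ] H, S (x : HilbertTensor E H) = T x) : S = T :=
  ContinuousLinearMap.ext fun x =>
    UniformSpace.Completion.induction_on x (isClosed_eq S.continuous T.continuous) h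

theorem norm_opTensor_le (A : E →L[ℂ] E) (T : H →L[ℂ] H) : ‖opTensor A T‖ ≤ ‖A‖ * ‖T‖ := by
  refine ContinuousLinearMap.opNorm_le_bound _ (by positivity) fun x => ?_
  refine UniformSpace.Completion.induction_on x
    (isClosed_le (by fun_prop) (by fun_prop)) fun x => ?_
  rw [opTensor_coe, UniformSpace.Completion.norm_coe, UniformSpace.Completion.norm_coe]
  exact ((TensorProduct.mapL A T).le_opNorm x).trans
    (mul_le_mul_of_nonneg_right (TensorProduct.norm_mapL_le A T) (norm_nonneg _))

theorem opTensor_add_left (A B : E →L[ℂ] E) (T : H →L[ℂ] H) :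
    opTensor (A + B) T = opTensor A T + opTensor B T :=
  hilbertTensor_clm_ext fun x => by
    rw [add_apply, opTensor_coe, opTensor_coe, opTensor_coe, TensorProduct.mapL_add_left, add_apply,
      UniformSpace.Completion.coe_add]

theorem opTensor_add_right (A : E →L[ℂ] E) (S T : H →L[ℂ] H) :
    opTensor A (S + T) = opTensor A S + opTensor A T :=
  hilbertTensor_clm_ext fun x => by
    rw [add_apply, opTensor_coe, opTensor_coe, opTensor_coe, TensorProduct.mapL_add_right,
      add_apply, UniformSpace.Completion.coe_add]

theorem opTensor_smul_left (c : ℂ) (A : E →L[ℂ] E) (T : H →L[ℂ] H) :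
    opTensor (c • A) T = c • opTensor A T :=
  hilbertTensor_clm_ext fun x => by
    rw [smul_apply, opTensor_coe, opTensor_coe, TensorProduct.mapL_smul_left, smul_apply,
      UniformSpace.Completion.coe_smul]

theorem opTensor_smul_right (c : ℂ) (A : E →L[ℂ] E) (T : H →L[ℂ] H) :
    opTensor A (c • T) = c • opTensor A T :=
  hilbertTensor_clm_ext fun x => by
    rw [smul_apply, opTensor_coe, opTensor_coe, TensorProduct.mapL_smul_right, smul_apply,
      UniformSpace.Completion.coe_smul]

/-- The additive map `A ↦ A ⊗ T`. -/
def opTensorLeft (T : H →L[ℂ] H) :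
    (E →L[ℂ] E) →+ (HilbertTensor E H →L[ℂ] HilbertTensor E H) :=
  AddMonoidHom.mk' (fun A => opTensor A T) fun A B => opTensor_add_left A B T

theorem continuous_opTensorLeft (T : H →L[ℂ] H) : Continuous (opTensorLeft (E := E) T) :=
  AddMonoidHomClass.continuous_of_bound (opTensorLeft (E := E) T) ‖T‖ fun A =>
    (norm_opTensor_le A T).trans_eq (mul_comm _ _)

/-- The additive map `T ↦ A ⊗ T`. -/
def opTensorRight (A : E →L[ℂ] E) :
    (H →L[ℂ] H) →+ (HilbertTensor E H →L[ℂ] HilbertTensor E H) :=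
  AddMonoidHom.mk' (fun T => opTensor A T) (opTensor_add_right A)

theorem continuous_opTensorRight (A : E →L[ℂ] E) : Continuous (opTensorRight (H := H) A) :=
  AddMonoidHomClass.continuous_of_bound (opTensorRight (H := H) A) ‖A‖ fun T => norm_opTensor_le A T

theorem hasSum_opTensor_left {ι : Type*} {f : ι → (E →L[ℂ] E)} {A : E →L[ℂ] E} (hf : HasSum f A)
    (T : H →L[ℂ] H) : HasSum (fun i => opTensor (f i) T) (opTensor A T) :=
  hf.map (opTensorLeft T) (continuous_opTensorLeft T)

theorem hasSum_opTensor_right {ι : Type*} {f : ι → (H →L[ℂ] H)} {T : H →L[ℂ] H} (hf : HasSum f T)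
    (A : E →L[ℂ] E) : HasSum (fun i => opTensor A (f i)) (opTensor A T) :=
  hf.map (opTensorRight A) (continuous_opTensorRight A)

theorem opTensor_sum_left {ι : Type*} (s : Finset ι) (f : ι → (E →L[ℂ] E)) (T : H →L[ℂ] H) :
    opTensor (∑ i ∈ s, f i) T = ∑ i ∈ s, opTensor (f i) T :=
  map_sum (opTensorLeft T) f s

theorem opTensor_sum_right {ι : Type*} (s : Finset ι) (f : ι → (H →L[ℂ] H)) (A : E →L[ℂ] E) :
    opTensor A (∑ i ∈ s, f i) = ∑ i ∈ s, opTensor A (f i) :=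
  map_sum (opTensorRight A) f s

theorem inner_opTensor_tmul (A : E →L[ℂ] E) (T : H →L[ℂ] H) (e e' : E) (h h' : H) :
    inner ℂ ((e ⊗ₜ[ℂ] h : E ⊗[ℂ] H) : HilbertTensor E H)
      (opTensor A T ((e' ⊗ₜ[ℂ] h' : E ⊗[ℂ] H) : HilbertTensor E H)) =
      inner ℂ e (A e') * inner ℂ h (T h') := by
  rw [opTensor_coe, UniformSpace.Completion.inner_coe, TensorProduct.mapL_tmul,
    TensorProduct.inner_tmul]

end OpTensor

/-! ### Homogeneity of blocks under scalings and the torus action -/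

section Scaling

open UnitAddTorus AddCircle

theorem list_ofFn_smul_prod {R : Type*} [Ring R] [Algebra ℂ R] {k : ℕ} (c : Fin k → ℂ)
    (T : Fin k → R) :
    (List.ofFn fun i => c i • T i).prod = (∏ i, c i) • (List.ofFn T).prod := by
  induction k with
  | zero => simp
  | succ k ih =>
    rw [List.ofFn_succ, List.prod_cons, ih, List.ofFn_succ, List.prod_cons, Fin.prod_univ_succ,
      smul_mul_smul_comm]

variable {H : Type*} [NormedAddCommGroup H] [InnerProductSpace ℂ H] [CompleteSpace H]

omit [CompleteSpace H] in
theorem monomial_word {m p : ℕ} (X : Fin m → (H →L[ℂ] H)) (w : Fin p → Fin m) :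
    monomial X (word w) = (List.ofFn fun j => X (w j)).prod := by
  rw [monomial, word, FreeMonoid.lift_ofList, List.map_ofFn]
  rfl

omit [CompleteSpace H] in
theorem monomial_smul_word {m p : ℕ} (X : Fin m → (H →L[ℂ] H)) (z : ℂ) (w : Fin p → Fin m) :
    monomial (z • X) (word w) = z ^ p • monomial X (word w) := by
  rw [monomial_word, monomial_word]
  simp only [Pi.smul_apply]
  rw [list_ofFn_smul_prod]
  simp

variable {k : ℕ} {n : Fin k → ℕ}

/-- The factor `∏ z_i^{m_i⁻} conj(z_i)^{m_i⁺}` by which the block of multi-degree `m` is multiplied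
when `X_i` is replaced by `z_i X_i`. -/
def phase (z : Fin k → ℂ) (m : Fin k → ℤ) : ℂ :=
  ∏ i, z i ^ (-m i).toNat * star (z i) ^ (m i).toNat

theorem biMonomial_smul (X : Tuple n H) (z : Fin k → ℂ) (m : Fin k → ℤ)
    (α : (i : Fin k) → (Fin (-m i).toNat → Fin (n i)))
    (β : (i : Fin k) → (Fin (m i).toNat → Fin (n i))) :
    biMonomial (fun i => z i • X i : Tuple n H) (fun i => word (α i)) (fun i => word (β i)) =
      phase z m • biMonomial X (fun i => word (α i)) (fun i => word (β i)) := by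
  simp only [biMonomial, monomial_smul_word, star_smul, list_ofFn_smul_prod, phase,
    Finset.prod_mul_distrib, star_pow, smul_mul_smul_comm]

variable {E : Type*} [NormedAddCommGroup E] [InnerProductSpace ℂ E]
  (A : ((i : Fin k) → FreeMonoid (Fin (n i))) → ((i : Fin k) → FreeMonoid (Fin (n i))) →
      (E →L[ℂ] E))

theorem pluriBlock_smul (X : Tuple n H) (z : Fin k → ℂ) (m : Fin k → ℤ) :
    pluriBlock A (fun i => z i • X i : Tuple n H) m = phase z m • pluriBlock A X m := by
  simp only [pluriBlock, biMonomial_smul, opTensor_smul_right, Finset.smul_sum]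

theorem phase_ofReal (ρ : ℝ) (m : Fin k → ℤ) :
    phase (fun _ => (ρ : ℂ)) m = (absWeight ρ m : ℂ) := by
  simp only [phase, absWeight, Complex.ofReal_prod]
  refine Finset.prod_congr rfl fun i _ => ?_
  rw [Complex.star_def, Complex.conj_ofReal, ← pow_add, ← Complex.ofReal_pow]
  congr 2
  omega

theorem pluriBlock_real_smul (X : Tuple n H) (ρ : ℝ) (m : Fin k → ℤ) :
    pluriBlock A ((ρ : ℂ) • X) m = (absWeight ρ m : ℂ) • pluriBlock A X m := by
  rw [← phase_ofReal]
  exact pluriBlock_smul A X (fun _ => (ρ : ℂ)) m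

/-- Scaling all variables by `0` leaves this block unchanged, because its phase is a product of
powers `0 ^ 0 = 1`. -/
theorem pluriBlock_zero_degree (X : Tuple n H) :
    pluriBlock A X 0 = pluriBlock A (0 : Tuple n H) 0 := by
  have h := pluriBlock_smul A X 0 0
  have e : (fun i => (0 : Fin k → ℂ) i • X i : Tuple n H) = 0 := by
    funext i; simp
  rw [e] at h
  simpa [phase] using h.symm

/-- The torus action `X ↦ (e^{-2πi t₁} X₁, …, e^{-2πi t_k} X_k)`. -/
def torusAct (t : UnitAddTorus (Fin k)) (X : Tuple n H) : Tuple n H :=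
  fun i => (fourier (-1) (t i) : ℂ) • X i

theorem fourier_natCast (p : ℕ) (x : UnitAddCircle) : (fourier (p : ℤ) x : ℂ) = fourier 1 x ^ p := by
  induction p with
  | zero => simp
  | succ p ih => rw [Nat.cast_succ, fourier_add, ih, pow_succ]

/-- Degree `m` carries `m⁺` adjoint factors and `m⁻` plain ones, so rotation by `fourier (-1)`
contributes the exponent `m⁺ - m⁻ = m`. -/
theorem phase_fourier (t : UnitAddTorus (Fin k)) (m : Fin k → ℤ) :
    phase (fun i => (fourier (-1) (t i) : ℂ)) m = mFourier m t := by
  simp only [phase, mFourier, ContinuousMap.coe_mk]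
  refine Finset.prod_congr rfl fun i _ => ?_
  rw [fourier_neg, Complex.star_def, Complex.conj_conj, ← map_pow, ← fourier_natCast,
    ← fourier_natCast, ← fourier_neg, ← fourier_add]
  congr 2
  omega

theorem pluriBlock_torusAct (X : Tuple n H) (t : UnitAddTorus (Fin k)) (m : Fin k → ℤ) :
    pluriBlock A (torusAct t X) m = mFourier m t • pluriBlock A X m := by
  rw [← phase_fourier]
  exact pluriBlock_smul A X _ m

theorem torusAct_mem {X : Tuple n H} (hX : X ∈ openPolyball n H) (t : UnitAddTorus (Fin k)) :
    torusAct t X ∈ openPolyball n H :=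
  torus_smul_mem_openPolyball hX fun _ => norm_fourier_apply _ _

end Scaling

/-! ### Positive pluriharmonic functions and Harnack equivalence -/

section Positive

open UnitAddTorus AddCircle

variable {H : Type*} [NormedAddCommGroup H] [InnerProductSpace ℂ H] [CompleteSpace H]
variable {k : ℕ} {n : Fin k → ℕ}
variable {E : Type*} [NormedAddCommGroup E] [InnerProductSpace ℂ E]
variable {A : ((i : Fin k) → FreeMonoid (Fin (n i))) → ((i : Fin k) → FreeMonoid (Fin (n i))) →
      (E →L[ℂ] E)}
  {F : Tuple n H → (HilbertTensor E H →L[ℂ] HilbertTensor E H)}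

theorem hasSum_inner_pluriBlock (hF : ∀ X ∈ openPolyball n H, HasSum (pluriBlock A X) (F X))
    {X : Tuple n H} (hX : X ∈ openPolyball n H) (x y : HilbertTensor E H) :
    HasSum (fun m => inner ℂ x (pluriBlock A X m y)) (inner ℂ x (F X y)) :=
  (hF X hX).mapL (matrixCoeff x y)

theorem hasSum_inner_torusAct (hF : ∀ X ∈ openPolyball n H, HasSum (pluriBlock A X) (F X))
    {X : Tuple n H} (hX : X ∈ openPolyball n H) (x y : HilbertTensor E H)
    (t : UnitAddTorus (Fin k)) :
    HasSum (fun m => inner ℂ x (pluriBlock A X m y) * mFourier m t)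
      (inner ℂ x (F (torusAct t X) y)) := by
  refine hasSum_of_eq (hasSum_inner_pluriBlock hF (torusAct_mem hX t) x y) fun m => ?_
  rw [pluriBlock_torusAct, smul_apply, inner_smul_right, mul_comm]

theorem inner_real_smul_eq_tsum (hF : ∀ X ∈ openPolyball n H, HasSum (pluriBlock A X) (F X))
    {X : Tuple n H} {ρ : ℝ} (hX : (ρ : ℂ) • X ∈ openPolyball n H) (x y : HilbertTensor E H) :
    inner ℂ x (F ((ρ : ℂ) • X) y) =
      ∑' m, (absWeight ρ m : ℂ) * inner ℂ x (pluriBlock A X m y) := by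
  rw [← (hasSum_inner_pluriBlock hF hX x y).tsum_eq]
  refine tsum_congr fun m => ?_
  rw [pluriBlock_real_smul, smul_apply, inner_smul_right]

/-- On the diagonal the blocks are Fourier coefficients of a nonnegative function, hence bounded by
the constant block. The bound is uniform in both `X` and `m`. -/
theorem norm_pluriBlock_le (hF : ∀ X ∈ openPolyball n H, HasSum (pluriBlock A X) (F X))
    (hpos : ∀ X ∈ openPolyball n H, 0 ≤ F X) {X : Tuple n H} (hX : X ∈ openPolyball n H)
    (m : Fin k → ℤ) : ‖pluriBlock A X m‖ ≤ 4 * ‖pluriBlock A (0 : Tuple n H) 0‖ := by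
  refine norm_le_of_numericalRadius_le
    (C := ‖pluriBlock A (0 : Tuple n H) 0‖) (by positivity) fun x => ?_
  have h := norm_fourierCoeff_le_of_nonneg (hasSum_inner_pluriBlock hF hX x x).summable
    (g := fun t => (inner ℂ x (F (torusAct t X) x)).re)
    (fun t => by
      rw [← (inner_eq_re_of_nonneg (hpos _ (torusAct_mem hX t)) x).1]
      exact hasSum_inner_torusAct hF hX x x t)
    (fun t => (inner_eq_re_of_nonneg (hpos _ (torusAct_mem hX t)) x).2) m
  refine h.trans ((Complex.re_le_norm _).trans ((norm_inner_le_norm _ _).trans ?_))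
  rw [pluriBlock_zero_degree]
  nlinarith [(pluriBlock A (0 : Tuple n H) 0).le_opNorm x, norm_nonneg x]

/-- Dominated convergence: the weights lie in `[0, 1]`, tend to `1`, and the undamped scalar series
converges absolutely. Weak convergence suffices for comparing quadratic forms. -/
theorem tendsto_inner_radial [Nontrivial H]
    (hF : ∀ X ∈ openPolyball n H, HasSum (pluriBlock A X) (F X))
    {X : Tuple n H} (hX : X ∈ openPolyball n H) (x y : HilbertTensor E H) :
    Filter.Tendsto (fun r : ℝ => inner ℂ x (F ((r : ℂ) • X) y)) (nhdsWithin 1 (Set.Ico 0 1))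
      (nhds (inner ℂ x (F X y))) := by
  have hs := hasSum_inner_pluriBlock hF hX x y
  have key : Filter.Tendsto
      (fun r : ℝ => ∑' m, (absWeight r m : ℂ) * inner ℂ x (pluriBlock A X m y))
      (nhdsWithin 1 (Set.Ico 0 1)) (nhds (∑' m, inner ℂ x (pluriBlock A X m y))) := by
    refine tendsto_tsum_of_dominated_convergence hs.summable.norm (fun m => ?_) ?_
    · have hc : Continuous fun r : ℝ => (absWeight r m : ℂ) * inner ℂ x (pluriBlock A X m y) := by
        unfold absWeight; fun_prop
      have := (hc.tendsto 1).mono_left (nhdsWithin_le_nhds (s := Set.Ico 0 1))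
      simpa [absWeight] using this
    · filter_upwards [self_mem_nhdsWithin] with r hr m
      rw [norm_mul, Complex.norm_of_nonneg (absWeight_nonneg hr.1 m)]
      exact mul_le_of_le_one_left (norm_nonneg _) (absWeight_le_one hr.1 hr.2.le m)
  rw [hs.tsum_eq] at key
  refine key.congr' ?_
  filter_upwards [self_mem_nhdsWithin] with r hr
  exact (inner_real_smul_eq_tsum hF (smul_mem_openPolyball_of_mem_closedPolyball
    (openPolyball_subset_closedPolyball hX) hr.1 hr.2) x y).symm

theorem le_of_radial_le [Nontrivial H] [CompleteSpace E]
    (hF : ∀ X ∈ openPolyball n H, HasSum (pluriBlock A X) (F X))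
    (hpos : ∀ X ∈ openPolyball n H, 0 ≤ F X) {X Y : Tuple n H} (hX : X ∈ openPolyball n H)
    (hY : Y ∈ openPolyball n H) {c : ℝ}
    (h : ∀ r : ℝ, 0 ≤ r → r < 1 → F ((r : ℂ) • X) ≤ (c : ℂ) • F ((r : ℂ) • Y)) :
    F X ≤ (c : ℂ) • F Y := by
  refine le_of_re_inner_le (.of_nonneg (hpos X hX)) ?_ fun x => ?_
  · rw [Complex.coe_smul]
    exact (IsSelfAdjoint.all c).smul (.of_nonneg (hpos Y hY))
  have hX' := (Complex.continuous_re.tendsto _).comp (tendsto_inner_radial hF hX x x)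
  have hY' := (Complex.continuous_re.tendsto _).comp
    ((tendsto_inner_radial hF hY x x).const_mul (c : ℂ))
  have : (nhdsWithin (1 : ℝ) (Set.Ico 0 1)).NeBot := by
    rw [← mem_closure_iff_nhdsWithin_neBot, closure_Ico zero_ne_one]
    exact ⟨zero_le_one, le_rfl⟩
  rw [smul_apply, inner_smul_right]
  refine le_of_tendsto_of_tendsto hX' hY' ?_
  filter_upwards [self_mem_nhdsWithin] with r hr
  have := re_inner_le_of_le (h r hr.1 hr.2) x
  rwa [smul_apply, inner_smul_right] at this

theorem harnack_bounds (hF : ∀ X ∈ openPolyball n H, HasSum (pluriBlock A X) (F X))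
    (hpos : ∀ X ∈ openPolyball n H, 0 ≤ F X) {X : Tuple n H} (hX : X ∈ openPolyball n H)
    {ρ : ℝ} (h0 : 0 ≤ ρ) (h1 : ρ < 1) (hρX : (ρ : ℂ) • X ∈ openPolyball n H)
    (x : HilbertTensor E H) :
    ((1 - ρ) / (1 + ρ)) ^ k * (inner ℂ x (pluriBlock A (0 : Tuple n H) 0 x)).re ≤
        (inner ℂ x (F ((ρ : ℂ) • X) x)).re ∧
      (inner ℂ x (F ((ρ : ℂ) • X) x)).re ≤ (∑' m : Fin k → ℤ, absWeight ρ m) *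
        (inner ℂ x (pluriBlock A (0 : Tuple n H) 0 x)).re := by
  have hs := (hasSum_inner_pluriBlock hF hX x x).summable
  have hf : ∀ t, HasSum (fun m => inner ℂ x (pluriBlock A X m x) * mFourier m t)
      ((inner ℂ x (F (torusAct t X) x)).re : ℂ) := fun t => by
    rw [← (inner_eq_re_of_nonneg (hpos _ (torusAct_mem hX t)) x).1]
    exact hasSum_inner_torusAct hF hX x x t
  have hg : ∀ t, 0 ≤ (inner ℂ x (F (torusAct t X) x)).re := fun t =>
    (inner_eq_re_of_nonneg (hpos _ (torusAct_mem hX t)) x).2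
  rw [inner_real_smul_eq_tsum hF hρX, ← pluriBlock_zero_degree A X]
  exact ⟨harnack_lower hs hf hg h0 h1, harnack_upper hs hf hg h0 h1⟩

/-- Both values are compared with the constant block, an upper bound for the first point and a lower
bound for the second. The constants depend only on `ρ`, `σ` and `k`, hence serve all `F`, `E` and
`r`. -/
theorem harnackDominated_of_mem_openPolyball [Nontrivial H] {X Y : Tuple n H}
    (hX : X ∈ openPolyball n H) (hY : Y ∈ openPolyball n H) : HarnackDominated X Y := by
  obtain ⟨ρ, hρ0, hρ1, X', hX', rfl⟩ := exists_eq_smul_of_mem_openPolyball hX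
  obtain ⟨σ, hσ0, hσ1, Y', hY', rfl⟩ := exists_eq_smul_of_mem_openPolyball hY
  have hone : 1 ≤ ∑' m : Fin k → ℤ, absWeight ρ m := by
    have h := (summable_absWeight hρ0.le hρ1).le_tsum 0
      (fun m _ => absWeight_nonneg (k := k) hρ0.le m)
    simpa [absWeight] using h
  set C := ∑' m : Fin k → ℤ, absWeight ρ m with hC
  set d := ((1 - σ) / (1 + σ)) ^ k with hd
  have hdpos : 0 < d := pow_pos (div_pos (by linarith) (by linarith)) _
  -- Domination with constant `c` carries the factor `c²`, hence the square root.
  refine ⟨Real.sqrt (C / d), Real.sqrt_pos.mpr (by positivity), ?_⟩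
  intro E _ _ _ _ F ⟨A, hF⟩ hpos r hr0 hr1
  have mem : ∀ {Z : Tuple n H}, Z ∈ openPolyball n H → (r : ℂ) • Z ∈ openPolyball n H := fun hZ =>
    smul_mem_openPolyball_of_mem_closedPolyball (openPolyball_subset_closedPolyball hZ) hr0 hr1
  rw [Real.sq_sqrt (by positivity), smul_comm, smul_comm (r : ℂ)]
  have mX : (ρ : ℂ) • (r : ℂ) • X' ∈ openPolyball n H := by rw [smul_comm]; exact mem hX
  have mY : (σ : ℂ) • (r : ℂ) • Y' ∈ openPolyball n H := by rw [smul_comm]; exact mem hY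
  refine le_of_re_inner_le (.of_nonneg (hpos _ mX)) ?_ fun x => ?_
  · rw [Complex.coe_smul]
    exact (IsSelfAdjoint.all _).smul (.of_nonneg (hpos _ mY))
  have h1 := (harnack_bounds hF hpos (mem hX') hρ0.le hρ1 mX x).2
  have h2 := (harnack_bounds hF hpos (mem hY') hσ0.le hσ1 mY x).1
  rw [smul_apply, inner_smul_right, Complex.re_ofReal_mul]
  refine h1.trans ?_
  rw [div_mul_eq_mul_div, le_div_iff₀ hdpos, mul_assoc, mul_comm _ d]
  exact mul_le_mul_of_nonneg_left h2 (by linarith)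

end Positive

end Polyball
end

noncomputable section
namespace Polyball

/-! ### Products of free holomorphic functions -/

section FreeHolomorphic

variable {H : Type*} [NormedAddCommGroup H] [InnerProductSpace ℂ H]
variable {m : ℕ}

/-- The homogeneous part `∑_{|α| = p} c_α X_α`. -/
def homPart (c : FreeMonoid (Fin m) → ℂ) (p : ℕ) (X : Fin m → (H →L[ℂ] H)) : H →L[ℂ] H :=
  ∑ w : Fin p → Fin m, c (word w) • monomial X (word w)

theorem homPart_smul (c : FreeMonoid (Fin m) → ℂ) (p : ℕ) (X : Fin m → (H →L[ℂ] H)) (z : ℂ) :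
    homPart c p (z • X) = z ^ p • homPart c p X := by
  simp only [homPart, monomial_smul_word, Finset.smul_sum]
  exact Finset.sum_congr rfl fun w _ => smul_comm _ _ _

/-- The convolution product of coefficients. -/
def conv (c d : FreeMonoid (Fin m) → ℂ) (γ : FreeMonoid (Fin m)) : ℂ :=
  ∑ x ∈ Finset.HasAntidiagonal.antidiagonal γ.toList.length,
    c (FreeMonoid.ofList (γ.toList.take x.1)) * d (FreeMonoid.ofList (γ.toList.drop x.1))

theorem word_append {p q : ℕ} (u : Fin p → Fin m) (v : Fin q → Fin m) :
    word (Fin.append u v) = word u * word v := by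
  rw [word, List.ofFn_fin_append]
  rfl

theorem homPart_conv (c d : FreeMonoid (Fin m) → ℂ) (N : ℕ) (X : Fin m → (H →L[ℂ] H)) :
    ∑ x ∈ Finset.HasAntidiagonal.antidiagonal N, homPart c x.1 X * homPart d x.2 X = homPart (conv c d) N X := by
  have h : homPart (conv c d) N X = ∑ x ∈ Finset.HasAntidiagonal.antidiagonal N, ∑ w : Fin N → Fin m,
      (c (FreeMonoid.ofList ((List.ofFn w).take x.1)) *
        d (FreeMonoid.ofList ((List.ofFn w).drop x.1))) • monomial X (word w) := by
    rw [homPart, Finset.sum_comm]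
    refine Finset.sum_congr rfl fun w _ => ?_
    rw [← Finset.sum_smul, conv]
    simp [word]
  rw [h]
  refine Finset.sum_congr rfl fun x hx => ?_
  obtain ⟨p, q⟩ := x
  obtain rfl := Finset.HasAntidiagonal.mem_antidiagonal.mp hx
  rw [← (Fin.appendEquiv p q).sum_comp, Fintype.sum_prod_type, homPart, homPart,
    Finset.sum_mul_sum]
  refine Finset.sum_congr rfl fun u _ => Finset.sum_congr rfl fun v _ => ?_
  have e : (Fin.appendEquiv p q) (u, v) = Fin.append u v := rfl
  have t : (List.ofFn (Fin.append u v)).take p = List.ofFn u := by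
    rw [List.ofFn_fin_append, List.take_left' (List.length_ofFn)]
  have t' : (List.ofFn (Fin.append u v)).drop p = List.ofFn v := by
    rw [List.ofFn_fin_append, List.drop_left' (List.length_ofFn)]
  rw [e, t, t', word_append, monomial, monomial, monomial, map_mul, smul_mul_smul_comm]
  rfl

/-- The coefficients of the constant function `1`. -/
def unitCoeff (m : ℕ) (γ : FreeMonoid (Fin m)) : ℂ := if γ.toList.length = 0 then 1 else 0

theorem homPart_unitCoeff (p : ℕ) (X : Fin m → (H →L[ℂ] H)) :
    homPart (unitCoeff m) p X = if p = 0 then 1 else 0 := by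
  have hw : ∀ w : Fin p → Fin m, unitCoeff m (word w) = if p = 0 then 1 else 0 := fun w => by
    simp [unitCoeff, word]
  simp only [homPart, hw]
  split_ifs with h
  · subst h
    rw [Fintype.sum_unique, one_smul, monomial_word, List.ofFn_zero, List.prod_nil]
  · simp

/-- The coefficients of `X ↦ f_α(X)`, where `f_j` has the coefficients `c j`. -/
def wordCoeff (c : Fin m → FreeMonoid (Fin m) → ℂ) (α : FreeMonoid (Fin m)) :
    FreeMonoid (Fin m) → ℂ :=
  α.toList.foldr (fun j d => conv (c j) d) (unitCoeff m)

variable [CompleteSpace H]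

/-- With `X = ρX'`, convergence at `X'` bounds the homogeneous parts there, and homogeneity supplies
the factor `ρ^p`. -/
theorem summable_norm_homPart {c : FreeMonoid (Fin m) → ℂ}
    (hc : ∀ X ∈ openBall m H, Summable fun p => homPart c p X)
    {X : Fin m → (H →L[ℂ] H)} (hX : X ∈ openBall m H) : Summable fun p => ‖homPart c p X‖ := by
  obtain ⟨ρ, h0, h1, X', hX', rfl⟩ := exists_eq_smul_of_mem_openBall hX
  obtain ⟨C, hC⟩ := (hc X' hX').tendsto_atTop_zero.norm.bddAbove_range
  refine Summable.of_nonneg_of_le (fun _ => norm_nonneg _) (fun p => ?_)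
    ((summable_geometric_of_lt_one h0.le h1).mul_right C)
  rw [homPart_smul, norm_smul, norm_pow, Complex.norm_of_nonneg h0.le]
  exact mul_le_mul_of_nonneg_left (hC ⟨p, rfl⟩) (by positivity)

theorem hasSum_homPart_conv {c d : FreeMonoid (Fin m) → ℂ}
    {f g : (Fin m → (H →L[ℂ] H)) → (H →L[ℂ] H)}
    (hf : ∀ X ∈ openBall m H, HasSum (fun p => homPart c p X) (f X))
    (hg : ∀ X ∈ openBall m H, HasSum (fun p => homPart d p X) (g X)) :
    ∀ X ∈ openBall m H, HasSum (fun p => homPart (conv c d) p X) (f X * g X) := by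
  intro X hX
  have h1 := summable_norm_homPart (fun X hX => (hf X hX).summable) hX
  have h2 := summable_norm_homPart (fun X hX => (hg X hX).summable) hX
  have h3 := (summable_norm_sum_mul_antidiagonal_of_summable_norm h1 h2).of_norm.hasSum
  rw [← tsum_mul_tsum_eq_tsum_sum_antidiagonal_of_summable_norm h1 h2, (hf X hX).tsum_eq,
    (hg X hX).tsum_eq] at h3
  exact hasSum_of_eq h3 fun N => (homPart_conv c d N X).symm

theorem hasSum_homPart_wordCoeff {c : Fin m → FreeMonoid (Fin m) → ℂ}
    {g : (Fin m → (H →L[ℂ] H)) → Fin m → (H →L[ℂ] H)}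
    (hg : ∀ j, ∀ X ∈ openBall m H, HasSum (fun p => homPart (c j) p X) (g X j))
    (α : FreeMonoid (Fin m)) :
    ∀ X ∈ openBall m H, HasSum (fun p => homPart (wordCoeff c α) p X) (monomial (g X) α) := by
  induction α using FreeMonoid.recOn with
  | one =>
    intro X _
    refine hasSum_of_eq (g := fun p => if p = 0 then 1 else 0) ?_ fun p => homPart_unitCoeff p X
    rw [monomial, map_one]
    exact hasSum_ite_eq 0 1
  | of_mul j α ih =>
    have h := hasSum_homPart_conv (hg j) ih
    intro X hX
    have e : monomial (g X) (FreeMonoid.of j * α) = g X j * monomial (g X) α := by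
      rw [monomial, map_mul, FreeMonoid.lift_eval_of]; rfl
    rw [e]
    exact h X hX

end FreeHolomorphic

/-! ### Expanding a block of `F` at `G(X)` -/

section Composition

variable {H : Type*} [NormedAddCommGroup H] [InnerProductSpace ℂ H] [CompleteSpace H]
variable {k : ℕ} {n : Fin k → ℕ}
variable {C : ∀ i, FreeMonoid (Fin (n i)) → FreeMonoid (Fin (n i)) → ℂ}
variable {G : (i : Fin k) → (Fin (n i) → (H →L[ℂ] H)) → (Fin (n i) → (H →L[ℂ] H))}

/-- The expansion naturally runs over pairs `(p, q)` of degrees in `ℕ^k`. For each `i` one of the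
two words is empty, and its function `1` has only a degree-zero part, so only pairs with `p i = 0`
or `q i = 0` survive; these are exactly the pairs `(l⁻, l⁺)` with `l ∈ ℤ^k`. -/
theorem hasSum_biMonomial_homPart
    (hC1 : ∀ i, C i 1 = unitCoeff (n i))
    (hC : ∀ i α, ∀ X ∈ openBall (n i) H,
      HasSum (fun p => homPart (C i α) p X) (monomial (G i X) α))
    {α β : (i : Fin k) → FreeMonoid (Fin (n i))} (hαβ : ∀ i, α i = 1 ∨ β i = 1)
    {X : Tuple n H} (hX : ∀ i, X i ∈ openBall (n i) H) :
    HasSum (fun l : Fin k → ℤ =>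
      (List.ofFn fun i => homPart (C i (α i)) (-l i).toNat (X i)).prod *
        (List.ofFn fun i => star (homPart (C i (β i)) (l i).toNat (X i))).prod)
      (biMonomial (fun i => G i (X i) : Tuple n H) α β) := by
  have hn : ∀ i (γ : FreeMonoid (Fin (n i))), Summable fun p => ‖homPart (C i γ) p (X i)‖ :=
    fun i γ => summable_norm_homPart (fun X hX => (hC i γ X hX).summable) (hX i)
  obtain ⟨s1, h1⟩ := hasSum_list_ofFn_prod (fun i p => homPart (C i (α i)) p (X i))
    fun i => hn i (α i)
  obtain ⟨s2, h2⟩ := hasSum_list_ofFn_prod (fun i p => star (homPart (C i (β i)) p (X i)))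
    fun i => (hn i (β i)).congr fun p => (norm_star _).symm
  have h3 := (summable_mul_of_summable_norm s1 s2).hasSum
  rw [← tsum_mul_tsum_of_summable_norm s1 s2, h1.tsum_eq, h2.tsum_eq] at h3
  have e : (List.ofFn fun i => ∑' p, homPart (C i (α i)) p (X i)).prod *
      (List.ofFn fun i => ∑' p, star (homPart (C i (β i)) p (X i))).prod =
      biMonomial (fun i => G i (X i) : Tuple n H) α β := by
    rw [biMonomial]
    simp only [(hC _ _ _ (hX _)).tsum_eq, (hC _ _ _ (hX _)).star.tsum_eq]
  rw [e] at h3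
  have hinj : Function.Injective fun l : Fin k → ℤ =>
      ((fun i => (-l i).toNat, fun i => (l i).toNat) : (Fin k → ℕ) × (Fin k → ℕ)) := by
    intro l l' h
    obtain ⟨ha, hb⟩ := Prod.mk.inj h
    funext i
    have h1 : (-l i).toNat = (-l' i).toNat := congrFun ha i
    have h2 : (l i).toNat = (l' i).toNat := congrFun hb i
    omega
  refine (hinj.hasSum_iff (fun x hx => ?_)).mpr h3
  obtain ⟨p, q⟩ := x
  obtain ⟨i, hpi, hqi⟩ : ∃ i, p i ≠ 0 ∧ q i ≠ 0 := by
    by_contra! hcon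
    refine hx ⟨fun i => (q i : ℤ) - p i, ?_⟩
    refine Prod.ext (funext fun i => ?_) (funext fun i => ?_)
    · change (-((q i : ℤ) - p i)).toNat = p i
      have := hcon i
      omega
    · change ((q i : ℤ) - p i).toNat = q i
      have := hcon i
      omega
  rcases hαβ i with h | h
  · refine mul_eq_zero_of_left (List.prod_eq_zero (List.mem_ofFn.mpr ⟨i, ?_⟩)) _
    rw [h, hC1, homPart_unitCoeff, if_neg hpi]
  · refine mul_eq_zero_of_right _ (List.prod_eq_zero (List.mem_ofFn.mpr ⟨i, ?_⟩))
    rw [h, hC1, homPart_unitCoeff, if_neg hqi, star_zero]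

/-- The coefficient of `X_γ X_δ*` in the expansion of `G(X)_α G(X)_β*`. -/
def biCoeff (C : ∀ i, FreeMonoid (Fin (n i)) → FreeMonoid (Fin (n i)) → ℂ)
    (α β γ δ : (i : Fin k) → FreeMonoid (Fin (n i))) : ℂ :=
  (∏ i, C i (α i) (γ i)) * ∏ i, star (C i (β i) (δ i))

theorem biMonomial_homPart_expand (α β : (i : Fin k) → FreeMonoid (Fin (n i))) (X : Tuple n H)
    (l : Fin k → ℤ) :
    (List.ofFn fun i => homPart (C i (α i)) (-l i).toNat (X i)).prod *
        (List.ofFn fun i => star (homPart (C i (β i)) (l i).toNat (X i))).prod =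
      ∑ γ : (i : Fin k) → (Fin (-l i).toNat → Fin (n i)),
        ∑ δ : (i : Fin k) → (Fin (l i).toNat → Fin (n i)),
          biCoeff C α β (fun i => word (γ i)) (fun i => word (δ i)) •
            biMonomial X (fun i => word (γ i)) (fun i => word (δ i)) := by
  simp only [homPart, star_sum, star_smul]
  rw [list_ofFn_prod_sum, list_ofFn_prod_sum, Finset.sum_mul_sum]
  refine Finset.sum_congr rfl fun γ _ => Finset.sum_congr rfl fun δ _ => ?_
  rw [list_ofFn_smul_prod, list_ofFn_smul_prod, smul_mul_smul_comm]
  rfl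

variable {E : Type*} [NormedAddCommGroup E] [InnerProductSpace ℂ E]

/-- The coefficients of `X ↦ pluriBlock A (G(X)) m`. -/
def compCoeff (C : ∀ i, FreeMonoid (Fin (n i)) → FreeMonoid (Fin (n i)) → ℂ)
    (A : ((i : Fin k) → FreeMonoid (Fin (n i))) → ((i : Fin k) → FreeMonoid (Fin (n i))) →
      (E →L[ℂ] E)) (m : Fin k → ℤ) (γ δ : (i : Fin k) → FreeMonoid (Fin (n i))) : E →L[ℂ] E :=
  ∑ α : (i : Fin k) → (Fin (-m i).toNat → Fin (n i)),
    ∑ β : (i : Fin k) → (Fin (m i).toNat → Fin (n i)),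
      biCoeff C (fun i => word (α i)) (fun i => word (β i)) γ δ •
        A (fun i => word (α i)) (fun i => word (β i))

theorem pluriBlock_compCoeff
    (A : ((i : Fin k) → FreeMonoid (Fin (n i))) → ((i : Fin k) → FreeMonoid (Fin (n i))) →
      (E →L[ℂ] E)) (m l : Fin k → ℤ) (X : Tuple n H) :
    pluriBlock (compCoeff C A m) X l =
      ∑ α : (i : Fin k) → (Fin (-m i).toNat → Fin (n i)),
        ∑ β : (i : Fin k) → (Fin (m i).toNat → Fin (n i)),
          opTensor (A (fun i => word (α i)) (fun i => word (β i)))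
            ((List.ofFn fun i => homPart (C i (word (α i))) (-l i).toNat (X i)).prod *
              (List.ofFn fun i => star (homPart (C i (word (β i))) (l i).toNat (X i))).prod) := by
  simp only [biMonomial_homPart_expand (fun i => word _) (fun i => word _), opTensor_sum_right,
    opTensor_smul_right, pluriBlock, compCoeff, opTensor_sum_left, opTensor_smul_left]
  rw [Finset.sum_congr rfl fun γ _ => Finset.sum_comm, Finset.sum_comm]
  refine Finset.sum_congr rfl fun α _ => ?_
  rw [Finset.sum_congr rfl fun γ _ => Finset.sum_comm, Finset.sum_comm]

theorem hasSum_pluriBlock_compCoeff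
    (hC1 : ∀ i, C i 1 = unitCoeff (n i))
    (hC : ∀ i α, ∀ X ∈ openBall (n i) H,
      HasSum (fun p => homPart (C i α) p X) (monomial (G i X) α))
    (A : ((i : Fin k) → FreeMonoid (Fin (n i))) → ((i : Fin k) → FreeMonoid (Fin (n i))) →
      (E →L[ℂ] E)) (m : Fin k → ℤ) {X : Tuple n H} (hX : ∀ i, X i ∈ openBall (n i) H) :
    HasSum (pluriBlock (compCoeff C A m) X)
      (pluriBlock A (fun i => G i (X i) : Tuple n H) m) := by
  refine hasSum_of_eq ?_ fun l => pluriBlock_compCoeff A m l X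
  refine hasSum_sum fun α _ => hasSum_sum fun β _ => hasSum_opTensor_right ?_ _
  refine hasSum_biMonomial_homPart hC1 hC (fun i => ?_) hX
  have hempty : ∀ {p : ℕ} (w : Fin p → Fin (n i)), p = 0 → word w = 1 := by
    rintro p w rfl; rfl
  rcases le_total (m i) 0 with h | h
  · exact Or.inr (hempty _ (by omega))
  · exact Or.inl (hempty _ (by omega))

end Composition

end Polyball
end

noncomputable section
namespace Polyball

/-! ### Shifts on a Hilbert basis indexed by a monoid -/

section ShiftModel

variable {H : Type*} [NormedAddCommGroup H] [InnerProductSpace ℂ H] [CompleteSpace H]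

omit [CompleteSpace H] in
theorem _root_.Orthonormal.countable_range {ι : Type*} [TopologicalSpace.SeparableSpace H]
    {v : ι → H} (hv : Orthonormal ℂ v) : Countable ι := by
  have hd : ∀ i j, i ≠ j → 1 < dist (v i) (v j) := by
    intro i j hij
    have h := @norm_sub_sq ℂ H _ _ _ (v i) (v j)
    rw [hv.2 hij, hv.1, hv.1, map_zero] at h
    rw [dist_eq_norm]
    nlinarith [norm_nonneg (v i - v j)]
  have hdis : (Set.univ : Set ι).PairwiseDisjoint fun i => Metric.ball (v i) (1 / 2) := by
    intro i _ j _ hij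
    exact Metric.ball_disjoint_ball (by linarith [hd i j hij])
  have := hdis.countable_of_isOpen (fun _ _ => Metric.isOpen_ball)
    fun i _ => ⟨v i, Metric.mem_ball_self (by norm_num)⟩
  exact Set.countable_univ_iff.mp this

/-- A Hilbert basis of `H` is countably infinite, so it can be relabelled by any countably infinite
set; this places the Fock space model on `H` itself. -/
theorem exists_hilbertBasis_index [TopologicalSpace.SeparableSpace H]
    (hH : ¬ FiniteDimensional ℂ H) (W : Type*) [Countable W] [Infinite W] :
    Nonempty (HilbertBasis W ℂ H) := by
  obtain ⟨w, b, -⟩ := exists_hilbertBasis ℂ H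
  have hc : Countable w := b.orthonormal.countable_range
  have hi : Infinite w := by
    by_contra hfin
    have : Finite w := not_infinite_iff_finite.mp hfin
    have := Fintype.ofFinite w
    exact hH b.toOrthonormalBasis.toBasis.finiteDimensional_of_finite
  obtain ⟨σ⟩ : Nonempty (W ≃ w) := nonempty_equiv_of_countable
  refine ⟨HilbertBasis.mk (v := b ∘ σ) (b.orthonormal.comp σ σ.injective) ?_⟩
  rw [EquivLike.range_comp, b.dense_span]

variable {W : Type*} (b : HilbertBasis W ℂ H)

omit [CompleteSpace H] in
theorem _root_.HilbertBasis.clm_ext {S T : H →L[ℂ] H} (h : ∀ w, S (b w) = T (b w)) : S = T := by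
  refine ContinuousLinearMap.ext_on (s := Set.range b) ?_ ?_
  · rw [Submodule.dense_iff_topologicalClosure_eq_top]
    exact b.dense_span
  · rintro _ ⟨w, rfl⟩
    exact h w

theorem _root_.HilbertBasis.exists_clm_of_injective {f : W → W} (hf : Function.Injective f) :
    ∃ V : H →L[ℂ] H, ∀ w, V (b w) = b (f w) := by
  classical
  have ho := (b.orthonormal.comp f hf).orthogonalFamily
  refine ⟨(ho.linearIsometry.comp b.repr.toLinearIsometry).toContinuousLinearMap, fun w => ?_⟩
  change ho.linearIsometry (b.repr (b w)) = _
  rw [b.repr_self, ho.linearIsometry_apply_single]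
  simp

variable [Monoid W] [IsLeftCancelMul W]

/-- The left regular representation of a left cancellative monoid indexing a Hilbert basis. -/
def leftShift : W →* (H →L[ℂ] H) where
  toFun a := (b.exists_clm_of_injective (mul_right_injective a)).choose
  map_one' := b.clm_ext fun w => by
    rw [(b.exists_clm_of_injective (mul_right_injective 1)).choose_spec]
    simp
  map_mul' a c := b.clm_ext fun w => by
    rw [mul_apply_eq_comp,
      (b.exists_clm_of_injective (mul_right_injective (a * c))).choose_spec,
      (b.exists_clm_of_injective (mul_right_injective c)).choose_spec,
      (b.exists_clm_of_injective (mul_right_injective a)).choose_spec, mul_assoc]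

theorem leftShift_apply (a w : W) : leftShift b a (b w) = b (a * w) :=
  (b.exists_clm_of_injective (mul_right_injective a)).choose_spec w

end ShiftModel

/-! ### Creation operators and recovery of coefficients -/

section FockModel

variable {H : Type*} [NormedAddCommGroup H] [InnerProductSpace ℂ H] [CompleteSpace H]
variable {k : ℕ} {n : Fin k → ℕ}

instance : IsLeftCancelMul ((i : Fin k) → FreeMonoid (Fin (n i))) :=
  ⟨fun _ _ _ h => funext fun i => mul_left_cancel (congrFun h i)⟩

theorem list_prod_mulSingle {l : List (Fin k)} (hl : l.Nodup) (hm : ∀ i, i ∈ l)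
    (α : (i : Fin k) → FreeMonoid (Fin (n i))) :
    (l.map fun i => (Pi.mulSingle i (α i) : (i : Fin k) → FreeMonoid (Fin (n i)))).prod = α := by
  have key : ∀ l : List (Fin k), l.Nodup → ∀ j,
      (l.map fun i => (Pi.mulSingle i (α i) : (i : Fin k) → FreeMonoid (Fin (n i)))).prod j =
        if j ∈ l then α j else 1 := by
    intro l hl j
    induction l with
    | nil => simp
    | cons a l ih =>
      obtain ⟨ha, hl'⟩ := List.nodup_cons.mp hl
      rw [List.map_cons, List.prod_cons, Pi.mul_apply, ih hl']
      by_cases hj : j = a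
      · subst hj
        simp [ha]
      · simp [hj]
  funext j
  rw [key l hl j, if_pos (hm j)]

variable (b : HilbertBasis ((i : Fin k) → FreeMonoid (Fin (n i))) ℂ H)

/-- The tuple of left creation operators. -/
def creation : Tuple n H := fun i j => leftShift b (Pi.mulSingle i (FreeMonoid.of j))

theorem monomial_creation (i : Fin k) (α : FreeMonoid (Fin (n i))) :
    monomial (creation b i) α = leftShift b (Pi.mulSingle i α) := by
  have h : FreeMonoid.lift (creation b i) = (leftShift b).comp (MonoidHom.mulSingle _ i) :=
    FreeMonoid.hom_eq fun j => by
      rw [FreeMonoid.lift_eval_of]; rfl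
  exact DFunLike.congr_fun h α

theorem creation_commute (s t : Fin k) (hst : s ≠ t) (p : Fin (n s)) (q : Fin (n t)) :
    Commute (creation b s p) (creation b t q) :=
  (Pi.mulSingle_commute hst _ _).map (leftShift b)

theorem biMonomial_creation (α β : (i : Fin k) → FreeMonoid (Fin (n i))) :
    biMonomial (creation b) α β = leftShift b α * star (leftShift b β) := by
  have h1 : (List.ofFn fun i => monomial (creation b i) (α i)).prod = leftShift b α := by
    conv_rhs => rw [← list_prod_mulSingle (List.nodup_finRange k) List.mem_finRange α, map_list_prod,
      List.map_map]
    rw [List.ofFn_eq_map]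
    simp only [monomial_creation]
    rfl
  have h2 : (List.ofFn fun i => star (monomial (creation b i) (β i))).prod =
      star (leftShift b β) := by
    -- The adjoint reverses products, so `β` is factored in the reversed order of coordinates;
    -- either order yields `β`.
    conv_rhs => rw [← list_prod_mulSingle (List.nodup_reverse.mpr (List.nodup_finRange k))
      (fun i => List.mem_reverse.mpr (List.mem_finRange i)) β, map_list_prod, List.map_map]
    rw [List.ofFn_eq_map]
    simp only [monomial_creation]
    have hs : ∀ L : List (H →L[ℂ] H), star L.reverse.prod = (L.map star).prod := by
      intro L
      induction L with
      | nil => simp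
      | cons a L ih => simp [ih]
    rw [List.map_reverse, hs, List.map_map]
    rfl
  rw [biMonomial, h1, h2]

/-- The coefficient at `b w` detects `δ * w = δ₀`; equal lengths in every coordinate force `w = 1`,
hence `δ = δ₀`. -/
theorem star_leftShift_apply {δ δ₀ : (i : Fin k) → FreeMonoid (Fin (n i))}
    (hlen : ∀ i, (δ i).toList.length = (δ₀ i).toList.length) [Decidable (δ = δ₀)] :
    star (leftShift b δ) (b δ₀) = if δ = δ₀ then b 1 else 0 := by
  classical
  refine b.repr.injective (lp.ext (funext fun w => ?_))
  rw [b.repr_apply_apply, b.repr_apply_apply, ContinuousLinearMap.star_eq_adjoint,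
    ContinuousLinearMap.adjoint_inner_right, leftShift_apply,
    orthonormal_iff_ite.mp b.orthonormal]
  have hw : δ * w = δ₀ ↔ δ = δ₀ ∧ w = 1 := by
    constructor
    · intro h
      have hw1 : w = 1 := by
        funext i
        have h1 := congrArg (fun x => (x i).toList.length) h
        simp only [Pi.mul_apply, FreeMonoid.toList_mul, List.length_append] at h1
        have h2 : (w i).toList.length = 0 := by have := hlen i; omega
        exact List.length_eq_zero_iff.mp h2
      exact ⟨by rw [← h, hw1, mul_one], hw1⟩
    · rintro ⟨rfl, rfl⟩
      exact mul_one _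
  by_cases h1 : δ = δ₀
  · rw [if_pos h1, orthonormal_iff_ite.mp b.orthonormal]
    simp [h1]
  · rw [if_neg h1, inner_zero_right, if_neg fun h => h1 (hw.mp h).1]

theorem word_injective {m p : ℕ} : Function.Injective (word : (Fin p → Fin m) → FreeMonoid (Fin m)) :=
  fun _ _ h => List.ofFn_injective h

theorem length_word {m p : ℕ} (w : Fin p → Fin m) : (word w).toList.length = p := by
  simp [word]

variable {E : Type*} [NormedAddCommGroup E] [InnerProductSpace ℂ E]
  (A : ((i : Fin k) → FreeMonoid (Fin (n i))) → ((i : Fin k) → FreeMonoid (Fin (n i))) →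
      (E →L[ℂ] E))

theorem norm_le_of_inner_le {K : Type*} [NormedAddCommGroup K] [InnerProductSpace ℂ K]
    {T : K →L[ℂ] K} {C : ℝ} (hC : 0 ≤ C) (h : ∀ x y, ‖inner ℂ x (T y)‖ ≤ C * (‖x‖ * ‖y‖)) :
    ‖T‖ ≤ C := by
  refine T.opNorm_le_bound hC fun y => ?_
  have h1 := h (T y) y
  rw [inner_self_eq_norm_sq_to_K, norm_pow, RCLike.norm_ofReal, abs_norm] at h1
  rcases (norm_nonneg (T y)).eq_or_lt with h0 | h0
  · rw [← h0]; positivity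
  · nlinarith

theorem norm_smul_hilbertTensor {E H : Type*} [NormedAddCommGroup E] [InnerProductSpace ℂ E]
    [NormedAddCommGroup H] [InnerProductSpace ℂ H] (c : ℂ)
    (T : HilbertTensor E H →L[ℂ] HilbertTensor E H) : ‖c • T‖ = ‖c‖ * ‖T‖ := by
  have gen : ∀ (K : Type _) [NormedAddCommGroup K] [InnerProductSpace ℂ K] (T : K →L[ℂ] K),
      ‖c • T‖ = ‖c‖ * ‖T‖ := fun K _ _ T => norm_smul c T
  exact gen _ T

/-- Within one block all words have prescribed lengths, so the adjoint shift keeps only `δ₀`,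
sending it to the vacuum `b 1`, and the pairing then keeps only `γ₀`. -/
theorem inner_pluriBlock_creation (l : Fin k → ℤ) (e e' : E)
    (γ₀ : (i : Fin k) → (Fin (-l i).toNat → Fin (n i)))
    (δ₀ : (i : Fin k) → (Fin (l i).toNat → Fin (n i))) :
    inner ℂ ((e ⊗ₜ[ℂ] b (fun i => word (γ₀ i)) : E ⊗[ℂ] H) : HilbertTensor E H)
      (pluriBlock A (creation b) l
        ((e' ⊗ₜ[ℂ] b (fun i => word (δ₀ i)) : E ⊗[ℂ] H) : HilbertTensor E H)) =
      inner ℂ e (A (fun i => word (γ₀ i)) (fun i => word (δ₀ i)) e') := by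
  classical
  have hterm : ∀ (γ : (i : Fin k) → (Fin (-l i).toNat → Fin (n i)))
      (δ : (i : Fin k) → (Fin (l i).toNat → Fin (n i))),
      inner ℂ (b fun i => word (γ₀ i)) (biMonomial (creation b) (fun i => word (γ i))
        (fun i => word (δ i)) (b fun i => word (δ₀ i))) =
        if γ = γ₀ ∧ δ = δ₀ then 1 else 0 := by
    intro γ δ
    have hinj : ∀ {L : Fin k → ℕ} (γ γ₀ : (i : Fin k) → (Fin (L i) → Fin (n i))),
        ((fun i => word (γ i)) = fun i => word (γ₀ i)) ↔ γ = γ₀ := fun γ γ₀ =>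
      ⟨fun h => funext fun i => word_injective (congrFun h i), fun h => by rw [h]⟩
    rw [biMonomial_creation, mul_apply_eq_comp,
      star_leftShift_apply b (fun i => by rw [length_word, length_word]),
      ← ContinuousLinearMap.adjoint_inner_left, ← ContinuousLinearMap.star_eq_adjoint,
      star_leftShift_apply b (fun i => by rw [length_word, length_word])]
    simp only [hinj]
    by_cases h1 : γ = γ₀ <;> by_cases h2 : δ = δ₀ <;> simp [h1, h2, b.orthonormal.1]
  have hexp : inner ℂ ((e ⊗ₜ[ℂ] b (fun i => word (γ₀ i)) : E ⊗[ℂ] H) : HilbertTensor E H)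
      (pluriBlock A (creation b) l
        ((e' ⊗ₜ[ℂ] b (fun i => word (δ₀ i)) : E ⊗[ℂ] H) : HilbertTensor E H)) =
      ∑ γ : (i : Fin k) → (Fin (-l i).toNat → Fin (n i)),
        ∑ δ : (i : Fin k) → (Fin (l i).toNat → Fin (n i)),
          inner ℂ e (A (fun i => word (γ i)) (fun i => word (δ i)) e') *
            if γ = γ₀ ∧ δ = δ₀ then 1 else 0 := by
    rw [← matrixCoeff_apply, pluriBlock, map_sum]
    refine Finset.sum_congr rfl fun γ _ => ?_
    rw [map_sum]
    refine Finset.sum_congr rfl fun δ _ => ?_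
    rw [matrixCoeff_apply, inner_opTensor_tmul, hterm]
  rw [hexp, Finset.sum_eq_single γ₀, Finset.sum_eq_single δ₀]
  · simp
  · intro δ _ h; simp [h]
  · simp
  · intro γ _ h; simp [h]
  · simp

theorem norm_coeff_le_norm_pluriBlock_creation (l : Fin k → ℤ)
    (γ : (i : Fin k) → (Fin (-l i).toNat → Fin (n i)))
    (δ : (i : Fin k) → (Fin (l i).toNat → Fin (n i))) :
    ‖A (fun i => word (γ i)) (fun i => word (δ i))‖ ≤ ‖pluriBlock A (creation b) l‖ := by
  refine norm_le_of_inner_le (ContinuousLinearMap.opNorm_nonneg _) fun e e' => ?_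
  rw [← inner_pluriBlock_creation b A l e e' γ δ]
  refine (norm_inner_le_norm _ _).trans ?_
  refine (mul_le_mul_of_nonneg_left ((pluriBlock A (creation b) l).le_opNorm _)
    (norm_nonneg _)).trans (le_of_eq ?_)
  rw [UniformSpace.Completion.norm_coe, UniformSpace.Completion.norm_coe, TensorProduct.norm_tmul,
    TensorProduct.norm_tmul, b.orthonormal.1, b.orthonormal.1]
  ring

end FockModel

/-! ### Coefficient bounds at a point of the polyball -/

section CoefficientBound

variable {H : Type*} [NormedAddCommGroup H] [InnerProductSpace ℂ H] [CompleteSpace H]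
variable {k : ℕ} {n : Fin k → ℕ}

/-- The point is a small multiple `t` of the creation tuple, and `c` undoes the scaling of the
block. Neither depends on `A`, so one point controls a whole family of coefficient systems. -/
theorem exists_mem_openPolyball_norm_coeff_le [TopologicalSpace.SeparableSpace H]
    (hH : ¬ FiniteDimensional ℂ H) (hk : 1 ≤ k) (hn : ∀ i, 1 ≤ n i)
    (E : Type*) [NormedAddCommGroup E] [InnerProductSpace ℂ E] :
    ∃ X ∈ openPolyball n H, ∀ l : Fin k → ℤ, ∃ c : ℝ,
      ∀ (A : ((i : Fin k) → FreeMonoid (Fin (n i))) → ((i : Fin k) → FreeMonoid (Fin (n i))) →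
          (E →L[ℂ] E))
        (γ : (i : Fin k) → (Fin (-l i).toNat → Fin (n i)))
        (δ : (i : Fin k) → (Fin (l i).toNat → Fin (n i))),
        ‖A (fun i => word (γ i)) (fun i => word (δ i))‖ ≤ c * ‖pluriBlock A X l‖ := by
  have : Nontrivial H := by
    by_contra h
    have := not_nontrivial_iff_subsingleton.mp h
    exact hH inferInstance
  have hcount : ∀ i, Countable (FreeMonoid (Fin (n i))) := fun i =>
    inferInstanceAs (Countable (List (Fin (n i))))
  have hinf : Infinite ((i : Fin k) → FreeMonoid (Fin (n i))) := by
    let i₀ : Fin k := ⟨0, hk⟩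
    let j₀ : Fin (n i₀) := ⟨0, hn i₀⟩
    refine Infinite.of_injective (fun p : ℕ =>
      (Pi.mulSingle i₀ (word fun _ : Fin p => j₀) : (i : Fin k) → FreeMonoid (Fin (n i)))) ?_
    intro p q h
    have h1 := congrArg (fun x => x.toList.length) (Pi.mulSingle_injective i₀ h)
    simpa [length_word] using h1
  obtain ⟨b⟩ := exists_hilbertBasis_index hH ((i : Fin k) → FreeMonoid (Fin (n i)))
  obtain ⟨t, ht, hmem⟩ := exists_pos_smul_mem_openPolyball (creation_commute b)
  refine ⟨_, hmem, fun l => ⟨(absWeight t l)⁻¹, fun A γ δ => ?_⟩⟩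
  have hw : 0 < absWeight t l := Finset.prod_pos fun i _ => pow_pos ht _
  rw [pluriBlock_real_smul, norm_smul_hilbertTensor, Complex.norm_of_nonneg hw.le, inv_mul_cancel_left₀ hw.ne']
  exact norm_coeff_le_norm_pluriBlock_creation b A l γ δ

end CoefficientBound

end Polyball
end

noncomputable section
namespace Polyball

/-! ### Pluriharmonicity of the composition -/

section CompositionTheorem

open UnitAddTorus

variable {H : Type*} [NormedAddCommGroup H] [InnerProductSpace ℂ H] [CompleteSpace H]
variable {k : ℕ} {n : Fin k → ℕ}
variable {E : Type*} [NormedAddCommGroup E] [InnerProductSpace ℂ E]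

theorem pluriBlock_smul_coeff (c : ℂ)
    (A : ((i : Fin k) → FreeMonoid (Fin (n i))) → ((i : Fin k) → FreeMonoid (Fin (n i))) →
      (E →L[ℂ] E)) (X : Tuple n H) (l : Fin k → ℤ) :
    pluriBlock (fun γ δ => c • A γ δ) X l = c • pluriBlock A X l := by
  simp only [pluriBlock, opTensor_smul_left, Finset.smul_sum]

/-- Cauchy estimate: the matrix entries of a block are Fourier coefficients of `Q` along a torus
orbit, which stays in the polyball. No positivity is needed. -/
theorem norm_pluriBlock_le_of_forall_norm_sum_le
    {B : ((i : Fin k) → FreeMonoid (Fin (n i))) → ((i : Fin k) → FreeMonoid (Fin (n i))) →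
      (E →L[ℂ] E)} {Q : Tuple n H → (HilbertTensor E H →L[ℂ] HilbertTensor E H)}
    (hQ : ∀ X ∈ openPolyball n H, HasSum (pluriBlock B X) (Q X)) {C : ℝ}
    (hC : ∀ X ∈ openPolyball n H, ‖Q X‖ ≤ C) {X : Tuple n H} (hX : X ∈ openPolyball n H)
    (l : Fin k → ℤ) : ‖pluriBlock B X l‖ ≤ C := by
  have hC0 : 0 ≤ C := (ContinuousLinearMap.opNorm_nonneg _).trans (hC X hX)
  refine norm_le_of_inner_le hC0 fun x y => ?_
  refine norm_fourierCoeff_le (hasSum_inner_pluriBlock hQ hX x y).summable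
    (fun t => hasSum_inner_torusAct hQ hX x y t) (fun t => ?_) l
  calc ‖inner ℂ x (Q (torusAct t X) y)‖ ≤ ‖x‖ * ‖Q (torusAct t X) y‖ := norm_inner_le_norm _ _
    _ ≤ ‖x‖ * (C * ‖y‖) := mul_le_mul_of_nonneg_left
        ((Q (torusAct t X)).le_of_opNorm_le (hC _ (torusAct_mem hX t)) y) (norm_nonneg _)
    _ = C * (‖x‖ * ‖y‖) := by ring

theorem hasSum_swap_of_norm_le {K : Type*} [NormedAddCommGroup K] [InnerProductSpace ℂ K]
    [CompleteSpace K] {ι κ : Type*} {T : ι → κ → (K →L[ℂ] K)} {u : ι → ℝ} {v : κ → ℝ}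
    (hu : Summable u) (hv : Summable v) (hu0 : ∀ i, 0 ≤ u i) (hv0 : ∀ j, 0 ≤ v j)
    (hT : ∀ i j, ‖T i j‖ ≤ u i * v j) {q : ι → (K →L[ℂ] K)} {p : κ → (K →L[ℂ] K)}
    {s : K →L[ℂ] K} (hq : ∀ i, HasSum (T i) (q i)) (hs : HasSum q s)
    (hp : ∀ j, HasSum (fun i => T i j) (p j)) : HasSum p s := by
  have htot : HasSum (fun x : ι × κ => T x.1 x.2) (∑' x : ι × κ, T x.1 x.2) :=
    (Summable.of_norm_bounded (hu.mul_of_nonneg hv hu0 hv0) fun x => hT x.1 x.2).hasSum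
  rw [(htot.prod_fiberwise hq).unique hs] at htot
  exact (((Equiv.prodComm _ _).hasSum_iff).mpr htot).prod_fiberwise hp

theorem ofReal_smul_mono_of_nonneg {K : Type*} [NormedAddCommGroup K] [InnerProductSpace ℂ K]
    [CompleteSpace K] {T : K →L[ℂ] K} (hT : 0 ≤ T) {a b : ℝ} (h : a ≤ b) :
    (a : ℂ) • T ≤ (b : ℂ) • T := by
  rw [Complex.coe_smul, Complex.coe_smul]
  refine le_of_re_inner_le ((IsSelfAdjoint.all a).smul (.of_nonneg hT))
    ((IsSelfAdjoint.all b).smul (.of_nonneg hT)) fun x => ?_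
  rw [← Complex.coe_smul, ← Complex.coe_smul, smul_apply,
    smul_apply, inner_smul_right, inner_smul_right, Complex.re_ofReal_mul,
    Complex.re_ofReal_mul]
  exact mul_le_mul_of_nonneg_right h (inner_eq_re_of_nonneg hT x).2

/-- The candidate coefficients are the sums over `m` of those of the `B m`. With `X = ρX'`, the
block of degree `l` of `B m` is at most `u m · ρ^|l|`, so the two summations may be exchanged. -/
theorem isFreePluriharmonic_of_double_series [TopologicalSpace.SeparableSpace H]
    (hH : ¬ FiniteDimensional ℂ H) (hk : 1 ≤ k) (hn : ∀ i, 1 ≤ n i) [CompleteSpace E]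
    {B : (Fin k → ℤ) → ((i : Fin k) → FreeMonoid (Fin (n i))) →
      ((i : Fin k) → FreeMonoid (Fin (n i))) → (E →L[ℂ] E)}
    {Q : (Fin k → ℤ) → Tuple n H → (HilbertTensor E H →L[ℂ] HilbertTensor E H)}
    {F : Tuple n H → (HilbertTensor E H →L[ℂ] HilbertTensor E H)} {u : (Fin k → ℤ) → ℝ}
    (hu : Summable u)
    (hB : ∀ m, ∀ X ∈ openPolyball n H, HasSum (pluriBlock (B m) X) (Q m X))
    (hQ : ∀ X ∈ openPolyball n H, HasSum (fun m => Q m X) (F X))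
    (hle : ∀ m, ∀ X ∈ openPolyball n H, ‖Q m X‖ ≤ u m) : IsFreePluriharmonic F := by
  have : Nontrivial H := by
    by_contra h
    have := not_nontrivial_iff_subsingleton.mp h
    exact hH inferInstance
  have hbd : ∀ m, ∀ X ∈ openPolyball n H, ∀ l, ‖pluriBlock (B m) X l‖ ≤ u m := fun m X hX l =>
    norm_pluriBlock_le_of_forall_norm_sum_le (hB m) (hle m) hX l
  obtain ⟨X₀, hX₀, hcoeff⟩ := exists_mem_openPolyball_norm_coeff_le hH hk hn E
  refine ⟨fun γ δ => ∑' m, B m γ δ, fun X hX => ?_⟩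
  obtain ⟨ρ, hρ0, hρ1, X', hX', rfl⟩ := exists_eq_smul_of_mem_openPolyball hX
  have hu0 : ∀ m, 0 ≤ u m := fun m =>
    (ContinuousLinearMap.opNorm_nonneg _).trans (hle m X' hX')
  refine hasSum_swap_of_norm_le (K := HilbertTensor E H)
    (T := fun m => pluriBlock (B m) ((ρ : ℂ) • X')) (q := fun m => Q m ((ρ : ℂ) • X'))
    (u := u) (v := absWeight ρ) hu (summable_absWeight hρ0.le hρ1) hu0
    (fun l => absWeight_nonneg hρ0.le l) (fun m l => ?_) (fun m => hB m _ hX) (hQ _ hX)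
    fun l => ?_
  · rw [pluriBlock_real_smul, norm_smul_hilbertTensor,
      Complex.norm_of_nonneg (absWeight_nonneg hρ0.le _), mul_comm]
    exact mul_le_mul_of_nonneg_right (hbd _ _ hX' _) (absWeight_nonneg hρ0.le _)
  refine hasSum_sum fun γ _ => hasSum_sum fun δ _ => hasSum_opTensor_left ?_ _
  refine Summable.hasSum ?_
  obtain ⟨c, hc⟩ := hcoeff l
  -- For fixed `γ, δ` the coefficients are dominated by the blocks at `X₀`, hence by a multiple of
  -- `u m`.
  refine Summable.of_norm_bounded (hu.mul_left |c|) fun m => (hc (B m) γ δ).trans ?_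
  refine (mul_le_mul_of_nonneg_right (le_abs_self c) (ContinuousLinearMap.opNorm_nonneg _)).trans ?_
  exact mul_le_mul_of_nonneg_left (hbd m X₀ hX₀ l) (abs_nonneg c)

theorem isFreePluriharmonic_comp [TopologicalSpace.SeparableSpace H]
    (hH : ¬ FiniteDimensional ℂ H) (hk : 1 ≤ k) (hn : ∀ i, 1 ≤ n i) [CompleteSpace E]
    {G : (i : Fin k) → (Fin (n i) → (H →L[ℂ] H)) → (Fin (n i) → (H →L[ℂ] H))}
    (hGhol : ∀ i j, IsFreeHolomorphic (fun X => G i X j))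
    (hGmaps : ∀ X ∈ openPolyball n H, (fun i => G i (X i)) ∈ closedPolyball n H)
    {F : Tuple n H → (HilbertTensor E H →L[ℂ] HilbertTensor E H)} (hF : IsFreePluriharmonic F)
    (hpos : ∀ X ∈ openPolyball n H, 0 ≤ F X) {r : ℝ} (hr0 : 0 ≤ r) (hr1 : r < 1) :
    IsFreePluriharmonic fun X : Tuple n H => F ((r : ℂ) • (fun i => G i (X i) : Tuple n H)) := by
  have : Nontrivial H := by
    by_contra h
    have := not_nontrivial_iff_subsingleton.mp h
    exact hH inferInstance
  obtain ⟨A, hA⟩ := hF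
  choose c hc using hGhol
  -- An intermediate radius `r < r' < 1`: the block bound is applied at `r' G(X)`, and the remaining
  -- factor `q = r / r'` gives the summable weight `q^|m|`.
  set r' : ℝ := (1 + r) / 2 with hr'
  set q : ℝ := r / r' with hq
  have hr'0 : 0 < r' := by rw [hr']; linarith
  have hr'1 : r' < 1 := by rw [hr']; linarith
  have hq0 : 0 ≤ q := div_nonneg hr0 hr'0.le
  have hq1 : q < 1 := by rw [hq, div_lt_one hr'0, hr']; linarith
  have hqr : q * r' = r := div_mul_cancel₀ _ hr'0.ne'
  have hmem : ∀ X ∈ openPolyball n H,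
      (r' : ℂ) • (fun i => G i (X i) : Tuple n H) ∈ openPolyball n H := fun X hX =>
    smul_mem_openPolyball_of_mem_closedPolyball (hGmaps X hX) hr'0.le hr'1
  have hmem' : ∀ X ∈ openPolyball n H,
      (r : ℂ) • (fun i => G i (X i) : Tuple n H) ∈ openPolyball n H := fun X hX =>
    smul_mem_openPolyball_of_mem_closedPolyball (hGmaps X hX) hr0 hr1
  refine isFreePluriharmonic_of_double_series hH hk hn
    (B := fun m γ δ => (absWeight r m : ℂ) • compCoeff (fun i => wordCoeff (c i)) A m γ δ)
    (Q := fun m X => pluriBlock A ((r : ℂ) • (fun i => G i (X i) : Tuple n H)) m)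
    (u := fun m => absWeight q m * (4 * ‖pluriBlock A (0 : Tuple n H) 0‖))
    ((summable_absWeight hq0 hq1).mul_right _) (fun m X hX => ?_) (fun X hX => hA _ (hmem' X hX))
    fun m X hX => ?_
  · rw [pluriBlock_real_smul]
    refine hasSum_of_eq ?_ fun l => pluriBlock_smul_coeff _ _ X l
    exact (hasSum_pluriBlock_compCoeff (G := G) (fun i => rfl)
      (fun i α => hasSum_homPart_wordCoeff (fun j => hc i j) α) A m hX.2.1).const_smul _
  · have e : (r : ℂ) • (fun i => G i (X i) : Tuple n H) =
        (q : ℂ) • (r' : ℂ) • (fun i => G i (X i) : Tuple n H) := by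
      rw [smul_smul, ← Complex.ofReal_mul, hqr]
    rw [e, pluriBlock_real_smul, norm_smul_hilbertTensor,
      Complex.norm_of_nonneg (absWeight_nonneg hq0 m)]
    exact mul_le_mul_of_nonneg_left (norm_pluriBlock_le hA hpos (hmem X hX) m)
      (absWeight_nonneg hq0 m)

end CompositionTheorem

/-! ### Transport of Harnack domination -/

section SchwarzPick

variable {H : Type*} [NormedAddCommGroup H] [InnerProductSpace ℂ H] [CompleteSpace H]
variable {k : ℕ} {n : Fin k → ℕ}

/-- Two radii are involved: `r` is fixed inside the composite test function, while the domination
hypothesis is used at the outer radius, which then tends to `1`. -/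
theorem HarnackDominatedWith.map [TopologicalSpace.SeparableSpace H] [Nontrivial H]
    (hH : ¬ FiniteDimensional ℂ H) (hk : 1 ≤ k) (hn : ∀ i, 1 ≤ n i)
    {G : (i : Fin k) → (Fin (n i) → (H →L[ℂ] H)) → (Fin (n i) → (H →L[ℂ] H))}
    (hGhol : ∀ i j, IsFreeHolomorphic (fun X => G i X j))
    (hGmaps : ∀ X ∈ openPolyball n H, (fun i => G i (X i)) ∈ closedPolyball n H)
    {X Y : Tuple n H} (hX : X ∈ openPolyball n H) (hY : Y ∈ openPolyball n H) {c : ℝ}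
    (h : HarnackDominatedWith c X Y) :
    HarnackDominatedWith (n := n) c (fun i => G i (X i)) (fun i => G i (Y i)) := by
  intro E _ _ _ _ F hF hpos r hr0 hr1
  have hcomp := isFreePluriharmonic_comp hH hk hn hGhol hGmaps hF hpos hr0 hr1
  have hpos' : ∀ X ∈ openPolyball n H, 0 ≤ F ((r : ℂ) • (fun i => G i (X i) : Tuple n H)) :=
    fun X hX => hpos _ (smul_mem_openPolyball_of_mem_closedPolyball (hGmaps X hX) hr0 hr1)
  have hrad := h E _ hcomp hpos'
  obtain ⟨A, hA⟩ := hcomp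
  exact le_of_radial_le hA hpos' hX hY hrad

theorem HarnackDominatedWith.mono [Nontrivial H] {X Y : Tuple n H} (hY : Y ∈ openPolyball n H)
    {c d : ℝ} (h0 : 0 ≤ c) (hcd : c ≤ d) (h : HarnackDominatedWith c X Y) :
    HarnackDominatedWith d X Y := by
  intro E _ _ _ _ F hF hpos r hr0 hr1
  refine (h E F hF hpos r hr0 hr1).trans ?_
  refine ofReal_smul_mono_of_nonneg (hpos _ ?_) (pow_le_pow_left₀ h0 hcd 2)
  exact smul_mem_openPolyball_of_mem_closedPolyball (openPolyball_subset_closedPolyball hY) hr0 hr1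

theorem exists_one_lt_harnackEquivWith [Nontrivial H] {X Y : Tuple n H}
    (hX : X ∈ openPolyball n H) (hY : Y ∈ openPolyball n H) :
    ∃ c : ℝ, 1 < c ∧ HarnackEquivWith c X Y := by
  obtain ⟨c, hc0, hc⟩ := harnackDominated_of_mem_openPolyball hX hY
  obtain ⟨d, hd0, hd⟩ := harnackDominated_of_mem_openPolyball hY hX
  exact ⟨c + d + 1, by linarith, hc.mono hY hc0.le (by linarith), hd.mono hX hd0.le (by linarith)⟩

end SchwarzPick

end Polyball
end

theorem theorem2p4 {k : ℕ} (hk : 1 ≤ k) (n : Fin k → ℕ) (hn : ∀ i, 1 ≤ n i)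
    {H : Type*} [NormedAddCommGroup H] [InnerProductSpace ℂ H] [CompleteSpace H]
    [TopologicalSpace.SeparableSpace H] (hH : ¬ FiniteDimensional ℂ H)
    (G : (i : Fin k) → (Fin (n i) → (H →L[ℂ] H)) → (Fin (n i) → (H →L[ℂ] H)))
    (hGhol : ∀ i j, Polyball.IsFreeHolomorphic (fun X => G i X j))
    (hGmaps : ∀ X ∈ Polyball.openPolyball n H,
      (fun i => G i (X i)) ∈ Polyball.closedPolyball n H)
    (X Y : Polyball.Tuple n H)
    (hX : X ∈ Polyball.openPolyball n H) (hY : Y ∈ Polyball.openPolyball n H) :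
    Polyball.HarnackEquiv X Y ∧
      Polyball.HarnackEquiv (n := n) (fun i => G i (X i)) (fun i => G i (Y i)) ∧
      Polyball.hyperbolicDist (n := n) (fun i => G i (X i)) (fun i => G i (Y i)) ≤
        Polyball.hyperbolicDist X Y := by
  have : Nontrivial H := by
    by_contra h
    have := not_nontrivial_iff_subsingleton.mp h
    exact hH inferInstance
  have hXY := Polyball.harnackDominated_of_mem_openPolyball hX hY
  have hYX := Polyball.harnackDominated_of_mem_openPolyball hY hX
  obtain ⟨c, hc1, hc⟩ := Polyball.exists_one_lt_harnackEquivWith hX hY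
  have hmap : ∀ c : ℝ, Polyball.HarnackEquivWith c X Y →
      Polyball.HarnackEquivWith (n := n) c (fun i => G i (X i)) (fun i => G i (Y i)) :=
    fun c h => ⟨h.1.map hH hk hn hGhol hGmaps hX hY, h.2.map hH hk hn hGhol hGmaps hY hX⟩
  refine ⟨⟨hXY, hYX⟩, ⟨⟨c, by linarith, (hmap c hc).1⟩, ⟨c, by linarith, (hmap c hc).2⟩⟩, ?_⟩
  -- The constants admissible for `X, Y` form a nonempty subset of those for the images. All exceed
  -- `1`, which bounds the infima below and keeps the logarithm in its monotone range.
  refine Real.log_le_log ?_ (csInf_le_csInf ⟨1, fun d hd => hd.1.le⟩ ⟨c, hc1, hc⟩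
    fun d hd => ⟨hd.1, hmap d hd.2⟩)
  exact lt_of_lt_of_le one_pos (le_csInf ⟨c, hc1, hmap c hc⟩ fun d hd => hd.1.le)
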